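/- Let $f$ be a probability distribution on the positive integers ($f(t)\ge 0$, $\sum_{t\ge1}f(t)=1$, $f(0)=0$) such that $\mathbf E[d]=\sum_{t\ge1}t\,f(t)$ and $\mathbf E[d^{4/3}]=\sum_{t\ge1}t^{4/3}f(t)$ are finite. For each $n$ let $\mathcal D_n$ be the distribution on $\{1,\dots,\lfloor\sqrt n/\log^2 n\rfloor\}$ with probabilities proportional to $f$ (well defined for all large $n$). Draw $d_1,\dots,d_n$ independently from $\mathcal D_n$, give vertex $i\in\{1,\dots,n\}$ $d_i$ stubs, choose a uniformly random perfect matching of the stubs (if the number of stubs is odd, a uniformly random matching that leaves exactly one stub unmatched), let each matched pair of stubs be an edge, and delete self-loops and parallel copies of edges, to obtain a random simple graph $G_n$ (the erased configuration model). Let $X_{i,n}$ be the size of the MinBucket bucket of vertex $i$, i.e. the number of edges $\{i,w\}$ of $G_n$ with $\deg_{G_n}(i)\le\deg_{G_n}(w)$; thus an edge between vertices of equal degree is counted in the buckets of both its endpoints. Then, the expectation being over both the degrees and the matching, $$\lim_{n\to\infty}\frac1n\,\mathbf E\Big[\sum_{i=1}^n\binom{X_{i,n}}2\Big]=\frac1{2(\mathbf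 E[d])^2}\sum_{t_1=1}^\infty\sum_{t_2=t_1}^\infty\sum_{t_3=t_1}^\infty t_1(t_1-1)\,t_2\,t_3\,f(t_1)f(t_2)f(t_3),$$ where the triple series converges. The limit is strictly positive whenever $f(1)<1$, so that it then lies in $(0,\infty)$. -/

import Mathlib

open Filter Topology

/-- The stubs (half-edges) of a degree sequence `d` on the vertex set `Fin n`:
vertex `v` carries `d v` stubs. -/
abbrev Stub {n : ℕ} (d : Fin n → ℕ) : Type := Σ v : Fin n, Fin (d v)

/-- The matchings of the stubs, encoded as involutions (a stub is sent to its partner).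
If the number of stubs is even, at most one fixed point means no fixed point, so these are exactly
the perfect matchings; if it is odd, exactly one stub stays unmatched. -/
def stubMatchings {n : ℕ} (d : Fin n → ℕ) : Finset (Equiv.Perm (Stub d)) :=
  Finset.univ.filter fun σ =>
    (∀ s, σ (σ s) = s) ∧ ∀ s t, σ s = s → σ t = t → s = t

/-- There is always such a matching, so the uniform average over them is a genuine one. -/
theorem stubMatchings_nonempty {n : ℕ} (d : Fin n → ℕ) : (stubMatchings d).Nonempty := by
  refine ⟨((Fintype.equivFin (Stub d)).trans Fin.revPerm).trans (Fintype.equivFin (Stub d)).symm, ?_⟩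
  simp only [stubMatchings, Finset.mem_filter, Finset.mem_univ, true_and]
  refine ⟨fun s => by simp, fun s t hs ht => ?_⟩
  apply (Fintype.equivFin (Stub d)).injective
  have hs' := congrArg (Fintype.equivFin (Stub d)) hs
  have ht' := congrArg (Fintype.equivFin (Stub d)) ht
  simp only [Equiv.trans_apply, Equiv.apply_symm_apply, Fin.revPerm_apply] at hs' ht'
  have h1 := congrArg Fin.val hs'
  have h2 := congrArg Fin.val ht'
  rw [Fin.val_rev] at h1 h2
  ext
  omega

/-- The simple graph obtained from a matching of the stubs by merging parallel edges and deleting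
self-loops: distinct vertices are adjacent iff some stub of one is matched to a stub of the
other. -/
def erasedGraph {n : ℕ} (d : Fin n → ℕ) (σ : Equiv.Perm (Stub d)) : SimpleGraph (Fin n) :=
  SimpleGraph.fromRel fun u v => ∃ (i : Fin (d u)) (j : Fin (d v)), σ ⟨u, i⟩ = ⟨v, j⟩

/-- Expectation of `g` of the random graph of the erased configuration model `ECM(d)`:
the matching of the stubs is uniformly random. -/
noncomputable def ecmExpectation {n : ℕ} (d : Fin n → ℕ) (g : SimpleGraph (Fin n) → ℝ) : ℝ :=
  (∑ σ ∈ stubMatchings d, g (erasedGraph d σ)) / ((stubMatchings d).card : ℝ)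

open Classical in
/-- The bucket size of `v`: the number of edges `{v, w}` of `G` with `deg v ≤ deg w`
(an edge between vertices of equal degree is in the buckets of both its ends). -/
noncomputable def bucketSize {n : ℕ} (G : SimpleGraph (Fin n)) (v : Fin n) : ℕ :=
  ((G.neighborFinset v).filter fun w => G.degree v ≤ G.degree w).card

/-- The number of paths of length two enumerated over all buckets. -/
noncomputable def bucketWork {n : ℕ} (G : SimpleGraph (Fin n)) : ℝ :=
  ∑ v : Fin n, ((bucketSize G v).choose 2 : ℝ)

/-- The degree cap `⌊√n / log² n⌋`. -/
noncomputable def degreeCap (n : ℕ) : ℕ :=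
  ⌊Real.sqrt (n : ℝ) / Real.log (n : ℝ) ^ 2⌋₊

/-- The truncated degree distribution: supported on `{1, …, ⌊√n / log² n⌋}` with probabilities
proportional to `f`. -/
noncomputable def truncatedProb (f : ℕ → ℝ) (n t : ℕ) : ℝ :=
  if t ∈ Finset.Icc 1 (degreeCap n) then f t / ∑ s ∈ Finset.Icc 1 (degreeCap n), f s else 0

/-- Expected work on `n` vertices: the `n` degrees are independent draws from the truncated
distribution, and the graph is then drawn from the erased configuration model. -/
noncomputable def expectedWork (f : ℕ → ℝ) (n : ℕ) : ℝ :=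
  ∑ d ∈ Fintype.piFinset fun _ : Fin n => Finset.Icc 1 (degreeCap n),
    (∏ i : Fin n, truncatedProb f n (d i)) * ecmExpectation d bucketWork

/-- The summand `t₁ (t₁ - 1) t₂ t₃ f(t₁) f(t₂) f(t₃)`, restricted to
`1 ≤ t₁`, `t₁ ≤ t₂`, `t₁ ≤ t₃`. -/
noncomputable def wedgeTerm (f : ℕ → ℝ) (t : ℕ × ℕ × ℕ) : ℝ :=
  if 1 ≤ t.1 ∧ t.1 ≤ t.2.1 ∧ t.1 ≤ t.2.2 then
    (t.1 : ℝ) * ((t.1 : ℝ) - 1) * (t.2.1 : ℝ) * (t.2.2 : ℝ) * f t.1 * f t.2.1 * f t.2.2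
  else 0

/-! Twice the work is the number of ordered wedges (v; w, w') with w ≠ w' both in the bucket of v
(`two_mul_bucketWork`). Up to erasure, such a wedge is a pair of distinct stubs of v whose partners
lie at two further vertices. Given the degrees, with N stubs in all, two prescribed disjoint pairs
of stubs are both matched with probability between 1/N² and 1/((N-1)(N-3)) (`le_matchAvg_pair`,
`matchAvg_pair_le`). The wedges whose three degrees are at most a fixed K therefore number about
W/N² on average, where W sums d_v(d_v-1)d_w d_w' over the ordered triples. Independence of the
degrees turns the expectation of W into n(n-1)(n-2) times a triple sum, and N/n concentrates at the
mean μ because the second moment of the truncated law is o(n).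

The rest is error, split pathwise in `card_bucketWedges_le` and `card_stubWedges_le`. (1) A vertex
of degree at most K that loses degree in the erasure spoils O(K²) wedges, and only o(n) such
vertices are expected. (2) If the centre has more than K stubs and keeps at least half of them, the
bucket condition on erased degrees still gives t₁ ≤ 2t₂ and t₁ ≤ 2t₃ for the original degrees. Then
t₁²t₂t₃ ≤ 2(t₁t₂t₃)^(4/3) (`wedge_weight_le`), so these wedges, and those with a small centre and a
large end, are controlled by the tail of the 4/3 moment beyond K. (3) A centre of degree above K
that loses more than half of its stubs has many self-loops or quadratically many pairs of
coincidences (`sq_le_of_two_mul_erasedDegree_lt`). With M the degree cap, the contribution is o(n)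
because M² = o(n) (`fourth_mul_sq_second_le`). Counting single coincidences would only give M₃M₂/n,
with M_k the k-th moment, and the 4/3 moment bounds this by a multiple of M^(7/3)/n, which need not
vanish; two coincidences give M₄M₂²/n², at most a multiple of M⁴/n².

For fixed K everything but the tail term vanishes as n → ∞ (`eventually_abs_sub_le`); then K → ∞. -/

/-- The average of `F` over the matchings of the stubs. -/
noncomputable def matchAvg {n : ℕ} (d : Fin n → ℕ) (F : Equiv.Perm (Stub d) → ℝ) : ℝ :=
  (∑ σ ∈ stubMatchings d, F σ) / ((stubMatchings d).card : ℝ)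

/-- The number of matchings containing all the pairs in `l`. -/
def matchCount {n : ℕ} (d : Fin n → ℕ) (l : List (Stub d × Stub d)) : ℕ :=
  ((stubMatchings d).filter fun σ => ∀ p ∈ l, σ p.1 = p.2).card

/-- The endpoints of a list of pairs. -/
def pairEnds {α : Type*} (l : List (α × α)) : List α := l.flatMap fun p => [p.1, p.2]

/-! ### Counting matchings that contain prescribed pairs -/

section Counting

variable {n : ℕ} {d : Fin n → ℕ}

theorem mem_stubMatchings {σ : Equiv.Perm (Stub d)} :
    σ ∈ stubMatchings d ↔ (∀ s, σ (σ s) = s) ∧ ∀ s t, σ s = s → σ t = t → s = t := by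
  simp [stubMatchings]

theorem card_stub (d : Fin n → ℕ) : Fintype.card (Stub d) = ∑ v, d v := by
  simp [Stub, Fintype.card_sigma]

theorem matchCount_nil : matchCount d [] = (stubMatchings d).card := by
  simp [matchCount]

theorem mem_pairEnds {α : Type*} {l : List (α × α)} {x : α} :
    x ∈ pairEnds l ↔ ∃ p ∈ l, x = p.1 ∨ x = p.2 := by
  simp [pairEnds]

theorem length_pairEnds {α : Type*} (l : List (α × α)) : (pairEnds l).length = 2 * l.length := by
  induction l with
  | nil => simp [pairEnds]
  | cons p l ih => simp only [pairEnds, List.flatMap_cons, List.length_append] at ih ⊢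
                   rw [ih]; simp; omega

theorem conj_mem_stubMatchings (τ : Equiv.Perm (Stub d)) {σ : Equiv.Perm (Stub d)}
    (hσ : σ ∈ stubMatchings d) : τ * σ * τ⁻¹ ∈ stubMatchings d := by
  rw [mem_stubMatchings] at hσ ⊢
  refine ⟨fun s => by simp [hσ.1], fun s t hs ht => ?_⟩
  simp only [Equiv.Perm.mul_apply] at hs ht
  have := hσ.2 (τ⁻¹ s) (τ⁻¹ t) (by rw [Equiv.Perm.eq_inv_iff_eq]; exact hs)
    (by rw [Equiv.Perm.eq_inv_iff_eq]; exact ht)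
  exact (τ⁻¹).injective this

/-- Conjugation by τ permutes the matchings. This symmetry replaces any explicit count of matchings:
with τ a transposition it makes all admissible partners of a stub equally likely. -/
theorem matchCount_le_map (τ : Equiv.Perm (Stub d)) (l : List (Stub d × Stub d)) :
    matchCount d l ≤ matchCount d (l.map (Prod.map τ τ)) := by
  refine Finset.card_le_card_of_injOn (fun σ => τ * σ * τ⁻¹) ?_ ?_
  · intro σ hσ
    simp only [Finset.coe_filter, Set.mem_ofPred_eq] at hσ ⊢
    refine ⟨conj_mem_stubMatchings τ hσ.1, ?_⟩
    intro p hp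
    obtain ⟨q, hq, rfl⟩ := List.mem_map.1 hp
    simp [hσ.2 q hq]
  · intro σ _ σ' _ h
    simpa using h

theorem map_swap_eq {α : Type*} [DecidableEq α] {l : List (α × α)} {x y : α}
    (hx : x ∉ pairEnds l) (hy : y ∉ pairEnds l) :
    l.map (Prod.map (Equiv.swap x y) (Equiv.swap x y)) = l := by
  conv_rhs => rw [← List.map_id l]
  refine List.map_congr_left fun p hp => ?_
  have h1 : ∀ z, z = p.1 ∨ z = p.2 → Equiv.swap x y z = z := fun z hz =>
    Equiv.swap_apply_of_ne_of_ne (fun h => hx (mem_pairEnds.2 ⟨p, hp, h ▸ hz⟩))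
      (fun h => hy (mem_pairEnds.2 ⟨p, hp, h ▸ hz⟩))
  ext1 <;> simp [h1]

theorem matchCount_swap_target {l : List (Stub d × Stub d)} {a b b' : Stub d} (hb : b ∉ pairEnds l)
    (hb' : b' ∉ pairEnds l) (hab : a ≠ b) (hab' : a ≠ b') :
    matchCount d ((a, b) :: l) ≤ matchCount d ((a, b') :: l) := by
  have := matchCount_le_map (Equiv.swap b b') ((a, b) :: l)
  rw [List.map_cons, map_swap_eq hb hb'] at this
  simpa [Equiv.swap_apply_of_ne_of_ne hab hab'] using this

theorem matchCount_swap_fixed {l : List (Stub d × Stub d)} {a a' : Stub d} (ha : a ∉ pairEnds l)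
    (ha' : a' ∉ pairEnds l) :
    matchCount d ((a, a) :: l) ≤ matchCount d ((a', a') :: l) := by
  have := matchCount_le_map (Equiv.swap a a') ((a, a) :: l)
  rw [List.map_cons, map_swap_eq ha ha'] at this
  simpa using this

theorem sum_matchCount_target (a : Stub d) (l : List (Stub d × Stub d)) :
    ∑ b, matchCount d ((a, b) :: l) = matchCount d l := by
  rw [matchCount, Finset.card_eq_sum_card_fiberwise (f := fun σ => σ a) (t := Finset.univ)
    (by intro; simp)]
  refine Finset.sum_congr rfl fun b _ => ?_
  rw [matchCount, Finset.filter_filter]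
  congr 1
  ext σ
  simp [and_comm]

/-- A matching leaves at most one stub unmatched, so the events summed are disjoint. -/
theorem sum_matchCount_fixed (l : List (Stub d × Stub d)) :
    ∑ a, matchCount d ((a, a) :: l) ≤ matchCount d l := by
  simp only [matchCount]
  rw [← Finset.card_biUnion]
  · refine Finset.card_le_card fun σ => ?_
    simp only [Finset.mem_biUnion, Finset.mem_filter, Finset.mem_univ, true_and]
    rintro ⟨a, h1, h2⟩
    exact ⟨h1, fun p hp => h2 p (List.mem_cons_of_mem _ hp)⟩
  · intro a _ b _ hab
    rw [Function.onFun, Finset.disjoint_left]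
    intro σ h1 h2
    rw [Finset.mem_filter, mem_stubMatchings] at h1 h2
    exact hab (h1.1.2 a b (h1.2 _ List.mem_cons_self) (h2.2 _ List.mem_cons_self))

theorem card_compl_pairEnds (l : List (Stub d × Stub d)) :
    Fintype.card (Stub d) - 2 * l.length ≤ ((pairEnds l).toFinsetᶜ).card := by
  rw [Finset.card_compl]
  have := List.toFinset_card_le (pairEnds l)
  rw [length_pairEnds] at this
  omega

/-- By symmetry every free target other than a has the same count, there are at least N - 2|l| - 1
of them, and the counts over all targets add up to that of l. -/
theorem matchCount_cons_le {l : List (Stub d × Stub d)} {a b : Stub d}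
    (hb : b ∉ pairEnds l) (hab : a ≠ b) :
    (Fintype.card (Stub d) - 2 * l.length - 1) * matchCount d ((a, b) :: l) ≤ matchCount d l := by
  calc _ ≤ (((pairEnds l).toFinsetᶜ).erase a).card * matchCount d ((a, b) :: l) := by
        refine Nat.mul_le_mul_right _ ?_
        have := card_compl_pairEnds l
        have := Finset.pred_card_le_card_erase (s := (pairEnds l).toFinsetᶜ) (a := a)
        omega
    _ = ∑ b' ∈ ((pairEnds l).toFinsetᶜ).erase a, matchCount d ((a, b) :: l) := by simp
    _ ≤ ∑ b' ∈ ((pairEnds l).toFinsetᶜ).erase a, matchCount d ((a, b') :: l) := by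
        refine Finset.sum_le_sum fun b' hb' => ?_
        simp only [Finset.mem_erase, Finset.mem_compl, List.mem_toFinset] at hb'
        exact matchCount_swap_target hb hb'.2 hab (Ne.symm hb'.1)
    _ ≤ _ := by
        rw [← sum_matchCount_target a l]
        exact Finset.sum_le_sum_of_subset (Finset.subset_univ _)

theorem matchCount_fixed_le {l : List (Stub d × Stub d)} {a : Stub d} (ha : a ∉ pairEnds l) :
    (Fintype.card (Stub d) - 2 * l.length) * matchCount d ((a, a) :: l) ≤ matchCount d l := by
  calc _ ≤ ((pairEnds l).toFinsetᶜ).card * matchCount d ((a, a) :: l) :=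
        Nat.mul_le_mul_right _ (card_compl_pairEnds l)
    _ = ∑ b' ∈ (pairEnds l).toFinsetᶜ, matchCount d ((a, a) :: l) := by simp
    _ ≤ ∑ b' ∈ (pairEnds l).toFinsetᶜ, matchCount d ((b', b') :: l) := by
        refine Finset.sum_le_sum fun b' hb' => ?_
        simp only [Finset.mem_compl, List.mem_toFinset] at hb'
        exact matchCount_swap_fixed ha hb'
    _ ≤ _ := le_trans (Finset.sum_le_sum_of_subset (Finset.subset_univ _)) (sum_matchCount_fixed l)

theorem matchCount_cons_eq_zero {l : List (Stub d × Stub d)} {a b : Stub d}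
    (ha : a ∉ pairEnds l) (hb : b ∈ pairEnds l) : matchCount d ((a, b) :: l) = 0 := by
  rw [matchCount, Finset.card_eq_zero, Finset.filter_eq_empty_iff]
  intro σ hσ h
  rw [mem_stubMatchings] at hσ
  obtain ⟨p, hp, h1⟩ := mem_pairEnds.1 hb
  have h2 : σ a = b := h (a, b) List.mem_cons_self
  have h3 := h p (List.mem_cons_of_mem _ hp)
  refine ha (mem_pairEnds.2 ⟨p, hp, ?_⟩)
  rcases h1 with h1 | h1
  · right; rw [← h3, ← h1, ← h2, hσ.1]
  · left; apply σ.injective; rw [h2, h3, h1]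

/-- The matchings containing l split according to the image of a: unmatched, or one of exactly N -
2|l| - 1 equivalent free targets. Being unmatched is no likelier than any one target, so it is
charged as one further target; this treats both parities of N at once. -/
theorem le_matchCount_cons {l : List (Stub d × Stub d)} {a b : Stub d} (hl : (pairEnds l).Nodup)
    (ha : a ∉ pairEnds l) (hb : b ∉ pairEnds l) (hab : a ≠ b) :
    matchCount d l ≤ (Fintype.card (Stub d) - 2 * l.length) * matchCount d ((a, b) :: l) := by
  have hcard : ((pairEnds l).toFinsetᶜ).card = Fintype.card (Stub d) - 2 * l.length := by
    rw [Finset.card_compl, List.toFinset_card_of_nodup hl, length_pairEnds]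
  have h1 : matchCount d l = matchCount d ((a, a) :: l) +
      (Fintype.card (Stub d) - 2 * l.length - 1) * matchCount d ((a, b) :: l) := by
    rw [← sum_matchCount_target a l, ← Finset.sum_add_sum_compl (pairEnds l).toFinset,
      Finset.sum_eq_zero, zero_add, ← Finset.add_sum_erase _ _ (a := a) (by simpa using ha)]
    · congr 1
      rw [← hcard, ← Finset.card_erase_of_mem (a := a) (by simpa using ha), ← smul_eq_mul,
        ← Finset.sum_const]
      refine Finset.sum_congr rfl fun b' hb' => ?_
      simp only [Finset.mem_erase, Finset.mem_compl, List.mem_toFinset] at hb'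
      exact le_antisymm (matchCount_swap_target hb'.2 hb (Ne.symm hb'.1) hab)
        (matchCount_swap_target hb hb'.2 hab (Ne.symm hb'.1))
    · intro x hx
      exact matchCount_cons_eq_zero ha (by simpa using hx)
  have h2 := matchCount_fixed_le ha
  have h3 : 2 ≤ Fintype.card (Stub d) - 2 * l.length := by
    rw [← hcard]
    have : ({a, b} : Finset (Stub d)) ⊆ (pairEnds l).toFinsetᶜ := by
      intro x hx
      simp only [Finset.mem_insert, Finset.mem_singleton] at hx
      rcases hx with rfl | rfl <;> simpa
    calc 2 = ({a, b} : Finset (Stub d)).card := (Finset.card_pair hab).symm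
      _ ≤ _ := Finset.card_le_card this
  obtain ⟨q, hq⟩ := Nat.exists_eq_add_of_le h3
  rw [hq] at h1 h2 ⊢
  have h4 : 2 + q - 1 = q + 1 := by omega
  rw [h4] at h1
  set x := matchCount d ((a, b) :: l)
  set z := matchCount d ((a, a) :: l)
  have h5 : z ≤ x := by
    by_contra h
    push Not at h
    nlinarith
  rw [h1]
  nlinarith

/-- Adding one pair costs a factor at most 2/N while 4|l| ≤ N. The second entries may repeat: such a
list is contained in no matching. This is what lets the union bounds below run over all targets. -/
theorem matchCount_le_of_disjoint (l : List (Stub d × Stub d)) (hs : (l.map Prod.fst).Nodup)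
    (hd : ∀ p ∈ l, ∀ q ∈ l, p.1 ≠ q.2) (hm : 4 * l.length ≤ Fintype.card (Stub d)) :
    (Fintype.card (Stub d) : ℝ) ^ l.length * matchCount d l
      ≤ 2 ^ l.length * (stubMatchings d).card := by
  induction l with
  | nil => simp [matchCount_nil]
  | cons p l ih =>
    obtain ⟨a, b⟩ := p
    simp only [List.map_cons, List.nodup_cons, List.mem_map, not_exists, not_and] at hs
    have ih := ih hs.2 (fun p hp q hq => hd p (by simp [hp]) q (by simp [hq]))
      (by rw [List.length_cons] at hm; omega)
    simp only [List.length_cons] at hm ⊢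
    have hab : a ≠ b := hd (a, b) (by simp) (a, b) (by simp)
    have ha : a ∉ pairEnds l := by
      intro h
      obtain ⟨q, hq, h1 | h1⟩ := mem_pairEnds.1 h
      · exact hs.1 q hq h1.symm
      · exact hd (a, b) (by simp) q (by simp [hq]) h1
    by_cases hb : b ∈ pairEnds l
    · rw [matchCount_cons_eq_zero ha hb]
      simp only [Nat.cast_zero, mul_zero]
      positivity
    · have h1 := matchCount_cons_le hb hab
      have h2 : ((Fintype.card (Stub d) - 2 * l.length - 1 : ℕ) : ℝ) *
          matchCount d ((a, b) :: l) ≤ matchCount d l := by exact_mod_cast h1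
      have h3 : (Fintype.card (Stub d) : ℝ) ≤
          2 * ((Fintype.card (Stub d) - 2 * l.length - 1 : ℕ) : ℝ) := by
        exact_mod_cast (by omega : Fintype.card (Stub d) ≤
          2 * (Fintype.card (Stub d) - 2 * l.length - 1))
      calc (Fintype.card (Stub d) : ℝ) ^ (l.length + 1) * matchCount d ((a, b) :: l)
          = (Fintype.card (Stub d) : ℝ) ^ l.length *
            (Fintype.card (Stub d) * matchCount d ((a, b) :: l)) := by ring
        _ ≤ (Fintype.card (Stub d) : ℝ) ^ l.length * (2 * matchCount d l) := by
            refine mul_le_mul_of_nonneg_left ?_ (by positivity)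
            have := mul_le_mul_of_nonneg_right h3 (Nat.cast_nonneg (α := ℝ)
              (matchCount d ((a, b) :: l)))
            linarith
        _ = 2 * ((Fintype.card (Stub d) : ℝ) ^ l.length * matchCount d l) := by ring
        _ ≤ 2 * (2 ^ l.length * (stubMatchings d).card) := by gcongr
        _ = _ := by ring

end Counting

/-! ### Probabilities under a uniform matching -/

section Average

variable {n : ℕ} {d : Fin n → ℕ}

theorem card_stubMatchings_pos (d : Fin n → ℕ) : (0 : ℝ) < (stubMatchings d).card := by
  exact_mod_cast (stubMatchings_nonempty d).card_pos

theorem matchAvg_mono {F G : Equiv.Perm (Stub d) → ℝ}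
    (h : ∀ σ ∈ stubMatchings d, F σ ≤ G σ) : matchAvg d F ≤ matchAvg d G :=
  div_le_div_of_nonneg_right (Finset.sum_le_sum h) (Nat.cast_nonneg _)

theorem matchAvg_nonneg {F : Equiv.Perm (Stub d) → ℝ}
    (h : ∀ σ ∈ stubMatchings d, 0 ≤ F σ) : 0 ≤ matchAvg d F :=
  div_nonneg (Finset.sum_nonneg h) (Nat.cast_nonneg _)

theorem matchAvg_add (F G : Equiv.Perm (Stub d) → ℝ) :
    matchAvg d (fun σ => F σ + G σ) = matchAvg d F + matchAvg d G := by
  simp [matchAvg, Finset.sum_add_distrib, add_div]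

theorem matchAvg_const_mul (c : ℝ) (F : Equiv.Perm (Stub d) → ℝ) :
    matchAvg d (fun σ => c * F σ) = c * matchAvg d F := by
  simp [matchAvg, ← Finset.mul_sum, mul_div_assoc]

theorem matchAvg_sum {ι : Type*} (s : Finset ι) (F : ι → Equiv.Perm (Stub d) → ℝ) :
    matchAvg d (fun σ => ∑ i ∈ s, F i σ) = ∑ i ∈ s, matchAvg d (F i) := by
  simp only [matchAvg]
  rw [Finset.sum_comm, Finset.sum_div]

theorem matchAvg_ite (l : List (Stub d × Stub d)) :
    matchAvg d (fun σ => if ∀ p ∈ l, σ p.1 = p.2 then 1 else 0)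
      = matchCount d l / (stubMatchings d).card := by
  simp [matchAvg, matchCount]

theorem matchAvg_ite_le (l : List (Stub d × Stub d)) (hs : (l.map Prod.fst).Nodup)
    (hd : ∀ p ∈ l, ∀ q ∈ l, p.1 ≠ q.2) (hm : 4 * l.length ≤ Fintype.card (Stub d))
    (hpos : 0 < Fintype.card (Stub d)) :
    matchAvg d (fun σ => if ∀ p ∈ l, σ p.1 = p.2 then 1 else 0)
      ≤ (2 / (Fintype.card (Stub d) : ℝ)) ^ l.length := by
  rw [matchAvg_ite, div_pow, div_le_div_iff₀ (card_stubMatchings_pos d) (by positivity), mul_comm]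
  exact matchCount_le_of_disjoint l hs hd hm

theorem matchAvg_apply_eq_le (a b : Stub d) (hm : 4 ≤ Fintype.card (Stub d)) :
    matchAvg d (fun σ => if σ a = b then 1 else 0) ≤ 2 / (Fintype.card (Stub d) : ℝ) := by
  by_cases hab : a = b
  · subst hab
    have h := matchAvg_ite [(a, a)]
    -- The case a = b is the event that a stays unmatched, of probability at most 1/N.
    simp only [List.mem_singleton, forall_eq] at h
    rw [h, div_le_div_iff₀ (card_stubMatchings_pos d) (by positivity)]
    have := matchCount_fixed_le (d := d) (l := []) (a := a) (by simp [pairEnds])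
    rw [matchCount_nil] at this
    have h2 : ((Fintype.card (Stub d) : ℕ) : ℝ) * matchCount d [(a, a)]
      ≤ (stubMatchings d).card := by exact_mod_cast this
    have := card_stubMatchings_pos d
    linarith
  · have h := matchAvg_ite_le [(a, b)] (by simp) (by simpa using hab) (by simpa using hm)
      (by omega)
    simpa using h

/-- The bound is attained for even N; for odd N the probability is 1/(N(N-2)), which is smaller.
Unlike `matchAvg_ite_le` this bound is sharp to leading order, as the limiting constant requires. -/
theorem matchAvg_pair_le {a b a' b' : Stub d} (h : ([a, b, a', b'] : List (Stub d)).Nodup)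
    (hm : 4 ≤ Fintype.card (Stub d)) :
    matchAvg d (fun σ => if σ a = a' ∧ σ b = b' then 1 else 0)
      ≤ 1 / (((Fintype.card (Stub d) : ℝ) - 1) * ((Fintype.card (Stub d) : ℝ) - 3)) := by
  have h0 := matchAvg_ite [(a, a'), (b, b')]
  simp only [List.mem_cons, List.not_mem_nil, or_false, forall_eq_or_imp, forall_eq] at h0
  simp only [List.nodup_cons, List.mem_cons, not_or, List.not_mem_nil, not_false_eq_true,
    List.nodup_nil, and_true] at h
  have h1 := matchCount_cons_le (d := d) (l := [(b, b')]) (a := a) (b := a')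
    (by simp [pairEnds]; tauto) (by tauto)
  have h2 := matchCount_cons_le (d := d) (l := []) (a := b) (b := b')
    (by simp [pairEnds]) (by tauto)
  rw [matchCount_nil] at h2
  simp only [List.length_cons, List.length_nil] at h1 h2
  have hm' : (4 : ℝ) ≤ Fintype.card (Stub d) := by exact_mod_cast hm
  rw [h0, div_le_div_iff₀ (card_stubMatchings_pos d) (by apply mul_pos <;> linarith)]
  obtain ⟨q, hq⟩ := Nat.exists_eq_add_of_le hm
  rw [hq] at h1 h2 ⊢
  have e1 : 4 + q - 2 * (0 + 1) - 1 = q + 1 := by omega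
  have e2 : 4 + q - 2 * 0 - 1 = q + 3 := by omega
  rw [e1] at h1
  rw [e2] at h2
  have : matchCount d [(a, a'), (b, b')] * ((q + 3) * (q + 1)) ≤ (stubMatchings d).card := by
    nlinarith
  have h3 : (matchCount d [(a, a'), (b, b')] : ℝ) * ((q + 3) * (q + 1)) ≤ (stubMatchings d).card := by
    exact_mod_cast this
  push_cast
  ring_nf at h3 ⊢
  linarith

theorem le_matchAvg_pair {a b a' b' : Stub d} (h : ([a, b, a', b'] : List (Stub d)).Nodup)
    (hm : 4 ≤ Fintype.card (Stub d)) :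
    1 / ((Fintype.card (Stub d) : ℝ) * (Fintype.card (Stub d) : ℝ)) ≤
    matchAvg d (fun σ => if σ a = a' ∧ σ b = b' then 1 else 0) := by
  have h0 := matchAvg_ite [(a, a'), (b, b')]
  simp only [List.mem_cons, List.not_mem_nil, or_false, forall_eq_or_imp, forall_eq] at h0
  simp only [List.nodup_cons, List.mem_cons, not_or, List.not_mem_nil, not_false_eq_true,
    List.nodup_nil, and_true] at h
  have h1 := le_matchCount_cons (d := d) (l := [(b, b')]) (a := a) (b := a')
    (by simp [pairEnds]; tauto) (by simp [pairEnds]; tauto) (by simp [pairEnds]; tauto) (by tauto)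
  have h2 := le_matchCount_cons (d := d) (l := []) (a := b) (b := b')
    (by simp [pairEnds]) (by simp [pairEnds]) (by simp [pairEnds]) (by tauto)
  rw [matchCount_nil] at h2
  simp only [List.length_cons, List.length_nil] at h1 h2
  have hm' : (4 : ℝ) ≤ Fintype.card (Stub d) := by exact_mod_cast hm
  rw [h0, div_le_div_iff₀ (by apply mul_pos <;> linarith) (card_stubMatchings_pos d)]
  have h3 : (stubMatchings d).card ≤
      matchCount d [(a, a'), (b, b')] * (Fintype.card (Stub d) * Fintype.card (Stub d)) := by
    have e1 : Fintype.card (Stub d) - 2 * (0 + 1) ≤ Fintype.card (Stub d) := by omega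
    have e2 : Fintype.card (Stub d) - 2 * 0 ≤ Fintype.card (Stub d) := by omega
    calc _ ≤ _ := h2
      _ ≤ Fintype.card (Stub d) * (Fintype.card (Stub d) * matchCount d [(a, a'), (b, b')]) :=
        Nat.mul_le_mul e2 (h1.trans (Nat.mul_le_mul_right _ e1))
      _ = _ := by ring
  rw [one_mul]
  exact_mod_cast h3

end Average

/-! ### Colour collisions -/

/-- The pairs of distinct elements of `S` on which `col` takes the same value. -/
def monoPairs {α β : Type*} [DecidableEq α] [DecidableEq β] (col : α → β) (S : Finset α) :
    Finset (α × α) :=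
  (S ×ˢ S).filter fun p => p.1 ≠ p.2 ∧ col p.1 = col p.2

/-- Inserting one element either shows a new colour or creates a new monochromatic pair. -/
theorem card_le_card_image_add_card_monoPairs {α β : Type*} [DecidableEq α] [DecidableEq β]
    (col : α → β) (S : Finset α) :
    S.card ≤ (S.image col).card + (monoPairs col S).card := by
  induction S using Finset.induction_on with
  | empty => simp
  | insert x S hx ih =>
    rw [Finset.card_insert_of_notMem hx, Finset.image_insert]
    have hsub : monoPairs col S ⊆ monoPairs col (insert x S) := by
      intro p hp
      simp only [monoPairs, Finset.mem_filter, Finset.mem_product, Finset.mem_insert] at hp ⊢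
      tauto
    by_cases h : col x ∈ S.image col
    · rw [Finset.insert_eq_of_mem h]
      obtain ⟨y, hy, hxy⟩ := Finset.mem_image.1 h
      have : (monoPairs col S).card < (monoPairs col (insert x S)).card := by
        refine Finset.card_lt_card ⟨hsub, fun h' => ?_⟩
        have h1 : (x, y) ∈ monoPairs col (insert x S) := by
          simp only [monoPairs, Finset.mem_filter, Finset.mem_product, Finset.mem_insert]
          refine ⟨⟨by simp, Or.inr hy⟩, fun e => hx (e ▸ hy), hxy.symm⟩
        have h2 := h' h1
        simp only [monoPairs, Finset.mem_filter, Finset.mem_product] at h2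
        exact hx h2.1.1
      omega
    · rw [Finset.card_insert_of_notMem h]
      have := Finset.card_le_card hsub
      omega

/-! ### Erasure for a fixed matching: lost degree, coincidences, wedges -/

section Pathwise

variable {n : ℕ} (d : Fin n → ℕ) (σ : Equiv.Perm (Stub d))

/-- The vertex to which the `i`-th stub of `v` is matched. -/
def stubColor (v : Fin n) (i : Fin (d v)) : Fin n := (σ ⟨v, i⟩).1

/-- The neighbours of `v` in the erased graph. -/
def erasedNbrs (v : Fin n) : Finset (Fin n) :=
  (Finset.univ.image (stubColor d σ v)).erase v

/-- The degree of `v` in the erased graph. -/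
def erasedDegree (v : Fin n) : ℕ := (erasedNbrs d σ v).card

/-- The bucket of `v` in the erased graph. -/
def erasedBucket (v : Fin n) : Finset (Fin n) :=
  (erasedNbrs d σ v).filter fun w => erasedDegree d σ v ≤ erasedDegree d σ w

/-- The ordered wedges of all buckets. -/
def bucketWedges : Finset (Fin n × Fin n × Fin n) :=
  Finset.univ.filter fun t =>
    t.2.1 ∈ erasedBucket d σ t.1 ∧ t.2.2 ∈ erasedBucket d σ t.1 ∧ t.2.1 ≠ t.2.2

/-- The number of stubs of `v` matched to a stub of `v`, or unmatched. -/
def loopCount (v : Fin n) : ℕ := (Finset.univ.filter fun i => stubColor d σ v i = v).card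

/-- The number of ordered pairs of stubs of `v` matched to the same other vertex. -/
def doubleCount (v : Fin n) : ℕ :=
  (Finset.univ.filter fun p : Fin (d v) × Fin (d v) =>
    p.1 ≠ p.2 ∧ stubColor d σ v p.1 = stubColor d σ v p.2 ∧ stubColor d σ v p.1 ≠ v).card

/-- The number of quadruples of distinct stubs of `v` consisting of two pairs as in
`doubleCount`. -/
def quadCount (v : Fin n) : ℕ :=
  (Finset.univ.filter fun p : (Fin (d v) × Fin (d v)) × (Fin (d v) × Fin (d v)) =>
    ([p.1.1, p.1.2, p.2.1, p.2.2] : List (Fin (d v))).Nodup ∧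
    (stubColor d σ v p.1.1 = stubColor d σ v p.1.2 ∧ stubColor d σ v p.1.1 ≠ v) ∧
    (stubColor d σ v p.2.1 = stubColor d σ v p.2.2 ∧ stubColor d σ v p.2.1 ≠ v)).card

variable {d σ}

theorem mem_erasedNbrs {v w : Fin n} :
    w ∈ erasedNbrs d σ v ↔ w ≠ v ∧ ∃ i, (σ ⟨v, i⟩).1 = w := by
  simp [erasedNbrs, stubColor]

theorem erasedGraph_adj (hσ : σ ∈ stubMatchings d) (v w : Fin n) :
    (erasedGraph d σ).Adj v w ↔ w ∈ erasedNbrs d σ v := by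
  rw [mem_erasedNbrs, erasedGraph, SimpleGraph.fromRel_adj, ne_comm]
  refine and_congr_right fun _ => ?_
  constructor
  · rintro (⟨i, j, h⟩ | ⟨i, j, h⟩)
    · exact ⟨i, by rw [h]⟩
    · refine ⟨j, ?_⟩
      rw [← h, (mem_stubMatchings.1 hσ).1]
  · rintro ⟨i, h⟩
    left
    subst h
    exact ⟨i, (σ ⟨v, i⟩).2, rfl⟩

theorem erasedNbrs_eq_image (v : Fin n) :
    erasedNbrs d σ v =
      (Finset.univ.filter fun i => stubColor d σ v i ≠ v).image (stubColor d σ v) := by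
  ext w
  simp only [erasedNbrs, Finset.mem_erase, Finset.mem_image, Finset.mem_univ, true_and,
    Finset.mem_filter]
  constructor
  · rintro ⟨h, i, rfl⟩
    exact ⟨i, h, rfl⟩
  · rintro ⟨i, h, rfl⟩
    exact ⟨h, i, rfl⟩

theorem erasedDegree_le (v : Fin n) : erasedDegree d σ v ≤ d v := by
  rw [erasedDegree, erasedNbrs]
  refine (Finset.card_erase_le).trans (Finset.card_image_le.trans ?_)
  simp

theorem stubColor_injective_of_erasedDegree_eq {v : Fin n} (h : erasedDegree d σ v = d v) :
    Function.Injective (stubColor d σ v) := by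
  have h1 : (Finset.univ.image (stubColor d σ v)).card = (Finset.univ : Finset (Fin (d v))).card := by
    refine le_antisymm Finset.card_image_le ?_
    rw [Finset.card_univ, Fintype.card_fin]
    exact h.symm.le.trans Finset.card_erase_le
  exact Finset.card_image_iff.1 h1 |> fun h => by
    rw [Finset.coe_univ] at h; exact Set.injOn_univ.1 h

theorem loopCount_add_card (v : Fin n) :
    loopCount d σ v + (Finset.univ.filter fun i => stubColor d σ v i ≠ v).card = d v := by
  rw [loopCount, Finset.card_filter_add_card_filter_not]
  simp

/-- Degree is lost only through a stub that returns to v or stays unmatched, or through two stubs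
with the same other endpoint. -/
theorem one_le_loopCount_add_doubleCount {v : Fin n} (h : erasedDegree d σ v ≠ d v) :
    1 ≤ loopCount d σ v + doubleCount d σ v := by
  have h1 := card_le_card_image_add_card_monoPairs (stubColor d σ v)
    (Finset.univ.filter fun i => stubColor d σ v i ≠ v)
  rw [← erasedNbrs_eq_image] at h1
  have h2 := loopCount_add_card (d := d) (σ := σ) v
  have h3 : (monoPairs (stubColor d σ v) (Finset.univ.filter fun i => stubColor d σ v i ≠ v)).card
      ≤ doubleCount d σ v := by
    refine Finset.card_le_card fun p hp => ?_
    simp only [monoPairs, Finset.mem_filter, Finset.mem_product, Finset.mem_univ, true_and] at hp ⊢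
    tauto
  have h4 := erasedDegree_le (d := d) (σ := σ) v
  rw [erasedDegree] at h h4
  omega

/-- With x the number of stubs lost to multiple edges, at least x ordered pairs coincide. Deleting
the two stubs of one such pair leaves at least x - 2 pairs, disjoint from it. -/
theorem mul_le_quadCount (v : Fin n) :
    (d v - loopCount d σ v - erasedDegree d σ v) *
      (d v - loopCount d σ v - erasedDegree d σ v - 2) ≤ quadCount d σ v := by
  set S := Finset.univ.filter fun i => stubColor d σ v i ≠ v with hS
  have hSc : S.card = d v - loopCount d σ v := by
    have := loopCount_add_card (d := d) (σ := σ) v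
    rw [← hS] at this
    omega
  set D := erasedDegree d σ v with hD
  have hD' : (S.image (stubColor d σ v)).card = D := by
    rw [hD, erasedDegree, erasedNbrs_eq_image]
  rw [← hSc]
  have h1 : S.card - D ≤ (monoPairs (stubColor d σ v) S).card := by
    have := card_le_card_image_add_card_monoPairs (stubColor d σ v) S
    omega
  have h2 : ∀ p : Fin (d v) × Fin (d v),
      S.card - D - 2 ≤ (monoPairs (stubColor d σ v) (S \ {p.1, p.2})).card := by
    intro p
    have h3 := card_le_card_image_add_card_monoPairs (stubColor d σ v) (S \ {p.1, p.2})
    have h4 : ((S \ {p.1, p.2}).image (stubColor d σ v)).card ≤ D := by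
      rw [← hD']
      exact Finset.card_le_card (Finset.image_subset_image Finset.sdiff_subset)
    have h5 := Finset.le_card_sdiff ({p.1, p.2} : Finset (Fin (d v))) S
    have h6 : ({p.1, p.2} : Finset (Fin (d v))).card ≤ 2 := Finset.card_le_two
    omega
  calc _ ≤ (monoPairs (stubColor d σ v) S).card * (S.card - D - 2) := Nat.mul_le_mul_right _ h1
    _ = ∑ p ∈ monoPairs (stubColor d σ v) S, (S.card - D - 2) := by simp
    _ ≤ ∑ p ∈ monoPairs (stubColor d σ v) S,
        (monoPairs (stubColor d σ v) (S \ {p.1, p.2})).card := Finset.sum_le_sum fun p _ => h2 p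
    _ = ((monoPairs (stubColor d σ v) S).sigma
        fun p => monoPairs (stubColor d σ v) (S \ {p.1, p.2})).card := by
        rw [Finset.card_sigma]
    _ ≤ quadCount d σ v := by
        refine Finset.card_le_card_of_injOn (fun q => (q.1, q.2)) ?_ ?_
        · rintro ⟨⟨a, b⟩, ⟨c, e⟩⟩ h
          simp only [hS, monoPairs, Finset.coe_sigma, Set.mem_sigma_iff,
            Finset.mem_filter, Finset.mem_product, Finset.mem_sdiff, Finset.mem_univ, true_and,
            Finset.mem_insert, Finset.mem_singleton, not_or, Finset.coe_filter,
            Set.mem_ofPred_eq] at h ⊢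
          simp only [List.nodup_cons, List.mem_cons, not_or, List.not_mem_nil, not_false_eq_true,
            List.nodup_nil, and_true]
          grind
        · rintro ⟨p, q⟩ _ ⟨p', q'⟩ _ h
          simp only [Prod.mk.injEq] at h
          obtain ⟨rfl, rfl⟩ := h
          rfl

/-- Either loops use at least a quarter of the stubs, or more than a quarter is lost to multiple
edges. In the second case x > d/4, and d ≥ 16 gives x - 2 ≥ d/8, whence the constant 32 = 4 · 8. -/
theorem sq_le_of_two_mul_erasedDegree_lt {v : Fin n} (h : 2 * erasedDegree d σ v < d v)
    (hd : 16 ≤ d v) : d v ^ 2 ≤ 4 * (d v * loopCount d σ v) + 32 * quadCount d σ v := by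
  by_cases hl : d v ≤ 4 * loopCount d σ v
  · nlinarith
  · have h1 := mul_le_quadCount (d := d) (σ := σ) v
    set x := d v - loopCount d σ v - erasedDegree d σ v with hx
    have h2 : d v ≤ 4 * x := by omega
    have h3 : d v ≤ 8 * (x - 2) := by omega
    nlinarith [Nat.mul_le_mul h2 h3]

/-- A bucket of size b has b(b - 1) ordered pairs of distinct members, twice the binomial
coefficient. -/
theorem two_mul_bucketWork (hσ : σ ∈ stubMatchings d) :
    2 * bucketWork (erasedGraph d σ) = (bucketWedges d σ).card := by
  have hdeg : ∀ v [Fintype ((erasedGraph d σ).neighborSet v)],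
      (erasedGraph d σ).degree v = erasedDegree d σ v := by
    intro v _
    rw [← SimpleGraph.card_neighborFinset_eq_degree, erasedDegree]
    refine congrArg Finset.card (Finset.ext fun w => ?_)
    rw [SimpleGraph.mem_neighborFinset, erasedGraph_adj hσ]
  have hb : ∀ v, bucketSize (erasedGraph d σ) v = (erasedBucket d σ v).card := by
    intro v
    rw [bucketSize, erasedBucket]
    refine congrArg Finset.card (Finset.ext fun w => ?_)
    rw [Finset.mem_filter, Finset.mem_filter, SimpleGraph.mem_neighborFinset, erasedGraph_adj hσ,
      hdeg, hdeg]
  have hw : (bucketWedges d σ).card = ∑ v, (erasedBucket d σ v).offDiag.card := by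
    rw [bucketWedges, Finset.card_eq_sum_card_fiberwise (f := fun t => t.1) (t := Finset.univ)
      (by intro; simp)]
    refine Finset.sum_congr rfl fun v _ => ?_
    refine Finset.card_bij (fun t _ => t.2) ?_ ?_ ?_
    · rintro ⟨a, b, c⟩ h
      simp only [Finset.mem_filter, Finset.mem_univ, true_and] at h
      obtain ⟨h, rfl⟩ := h
      exact Finset.mem_offDiag.2 h
    · rintro ⟨a, b, c⟩ h ⟨a', b', c'⟩ h' e
      simp only [Finset.mem_filter, Finset.mem_univ, true_and] at h h' e
      rw [h.2, h'.2, e]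
    · rintro ⟨b, c⟩ h
      exact ⟨(v, b, c), by simpa using Finset.mem_offDiag.1 h, rfl⟩
  rw [hw, bucketWork, Finset.mul_sum]
  push_cast
  refine Finset.sum_congr rfl fun v _ => ?_
  rw [hb, Nat.cast_choose_two, Finset.offDiag_card, Nat.cast_sub (Nat.le_mul_self _)]
  push_cast
  ring

end Pathwise

/-! ### Sandwiching bucket wedges between stub wedges -/

/-- `s`, `s'` are distinct stubs of one vertex and `u`, `u'` are stubs of two further vertices. -/
abbrev IsStubWedge {n : ℕ} {d : Fin n → ℕ} (s s' u u' : Stub d) : Prop :=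
  s ≠ s' ∧ s.1 = s'.1 ∧ u.1 ≠ s.1 ∧ u'.1 ≠ s.1 ∧ u.1 ≠ u'.1

/-- All three degrees are at most `K`, and the middle one is the smallest. -/
abbrev CapOrdered (K t₁ t₂ t₃ : ℕ) : Prop :=
  t₁ ≤ t₂ ∧ t₁ ≤ t₃ ∧ t₁ ≤ K ∧ t₂ ≤ K ∧ t₃ ≤ K

/-- Some degree exceeds `K`, and the middle one is at most twice either of the others. -/
abbrev TailOrdered (K t₁ t₂ t₃ : ℕ) : Prop :=
  t₁ ≤ 2 * t₂ ∧ t₁ ≤ 2 * t₃ ∧ (K < t₁ ∨ K < t₂ ∨ K < t₃)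

section Sandwich

variable {n : ℕ} (d : Fin n → ℕ) (σ : Equiv.Perm (Stub d))

/-- The pairs of stubs whose partners form a wedge with degrees satisfying `R`. -/
def stubWedges (R : ℕ → ℕ → ℕ → Prop) [∀ a b c, Decidable (R a b c)] :
    Finset (Stub d × Stub d) :=
  Finset.univ.filter fun p => IsStubWedge p.1 p.2 (σ p.1) (σ p.2) ∧
    R (d p.1.1) (d (σ p.1).1) (d (σ p.2).1)

/-- The vertices with at most `K` stubs that lose some of their degree in the erasure. -/
def lossyVertices (K : ℕ) : Finset (Fin n) :=
  Finset.univ.filter fun v => erasedDegree d σ v ≠ d v ∧ d v ≤ K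

/-- The pairs of stubs of one vertex with a lossy vertex at its centre or at an end. -/
def lossyPairs (K : ℕ) : Finset (Stub d × Stub d) :=
  (Finset.univ.filter fun p => p.1.1 = p.2.1 ∧ p.1.1 ∈ lossyVertices d σ K) ∪
  ((Finset.univ.filter fun p => p.1.1 = p.2.1 ∧ d p.1.1 ≤ K ∧ (σ p.1).1 ∈ lossyVertices d σ K) ∪
  (Finset.univ.filter fun p => p.1.1 = p.2.1 ∧ d p.1.1 ≤ K ∧ (σ p.2).1 ∈ lossyVertices d σ K))

/-- The pairs of stubs of one vertex of degree above `K` that loses more than half of its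
degree. -/
def halvedPairs (K : ℕ) : Finset (Stub d × Stub d) :=
  Finset.univ.filter fun p => p.1.1 = p.2.1 ∧ 2 * erasedDegree d σ p.1.1 < d p.1.1 ∧ K < d p.1.1

variable {d σ}

theorem stub_ext {s t : Stub d} (h : s.1 = t.1) (h' : (s.2 : ℕ) = t.2) : s = t := by
  obtain ⟨v, i⟩ := s
  obtain ⟨w, j⟩ := t
  obtain rfl : v = w := h
  obtain rfl : i = j := Fin.ext h'
  rfl

/-- Each pair is encoded by a lossy vertex, the index of a stub there, and the index of a second
stub, both indices below K. The three kinds of lossy pairs are all counted this way: when the lossy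
vertex is an end, injectivity of σ recovers the stub at the centre, hence the centre itself. -/
theorem card_le_mul_sq_of_injOn {A : Finset (Stub d × Stub d)} (K : ℕ)
    (g : Stub d × Stub d → Stub d × Stub d)
    (hg : ∀ p ∈ A, (g p).1.1 ∈ lossyVertices d σ K ∧ d (g p).2.1 ≤ K)
    (hinj : ∀ p ∈ A, ∀ q ∈ A, (g p).1 = (g q).1 → ((g p).2.2 : ℕ) = (g q).2.2 → p = q) :
    A.card ≤ K ^ 2 * (lossyVertices d σ K).card := by
  calc A.card ≤ (lossyVertices d σ K ×ˢ (Finset.range K ×ˢ Finset.range K)).card := by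
        refine Finset.card_le_card_of_injOn
          (fun p => ((g p).1.1, ((g p).1.2 : ℕ), ((g p).2.2 : ℕ))) ?_ ?_
        · intro p hp
          obtain ⟨h1, h2⟩ := hg p hp
          have h3 : d (g p).1.1 ≤ K := (Finset.mem_filter.1 h1).2.2
          simp only [Finset.coe_product, Set.mem_prod, Finset.mem_coe, Finset.mem_range]
          exact ⟨h1, lt_of_lt_of_le (g p).1.2.2 h3, lt_of_lt_of_le (g p).2.2.2 h2⟩
        · intro p hp q hq h
          simp only [Prod.mk.injEq] at h
          exact hinj p hp q hq (stub_ext h.1 h.2.1) h.2.2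
    _ = _ := by
        rw [Finset.card_product, Finset.card_product, Finset.card_range]
        ring

theorem card_lossyPairs_le (K : ℕ) :
    (lossyPairs d σ K).card ≤ 3 * K ^ 2 * (lossyVertices d σ K).card := by
  have h0 : (Finset.univ.filter fun p : Stub d × Stub d =>
      p.1.1 = p.2.1 ∧ p.1.1 ∈ lossyVertices d σ K).card
      ≤ K ^ 2 * (lossyVertices d σ K).card := by
    refine card_le_mul_sq_of_injOn K id ?_ ?_
    · intro p hp
      simp only [Finset.mem_filter, Finset.mem_univ, true_and] at hp
      refine ⟨hp.2, ?_⟩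
      rw [id, ← hp.1]
      exact (Finset.mem_filter.1 hp.2).2.2
    · intro p hp q hq h h'
      simp only [Finset.mem_filter, Finset.mem_univ, true_and, id] at hp hq h h'
      exact Prod.ext h (stub_ext (by rw [← hp.1, ← hq.1, h]) h')
  have h1 : (Finset.univ.filter fun p : Stub d × Stub d =>
      p.1.1 = p.2.1 ∧ d p.1.1 ≤ K ∧ (σ p.1).1 ∈ lossyVertices d σ K).card
      ≤ K ^ 2 * (lossyVertices d σ K).card := by
    refine card_le_mul_sq_of_injOn K (fun p => (σ p.1, p.2)) ?_ ?_
    · intro p hp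
      simp only [Finset.mem_filter, Finset.mem_univ, true_and] at hp
      exact ⟨hp.2.2, by rw [← hp.1]; exact hp.2.1⟩
    · intro p hp q hq h h'
      simp only [Finset.mem_filter, Finset.mem_univ, true_and] at hp hq h h'
      have h := σ.injective h
      exact Prod.ext h (stub_ext (by rw [← hp.1, ← hq.1, h]) h')
  have h2 : (Finset.univ.filter fun p : Stub d × Stub d =>
      p.1.1 = p.2.1 ∧ d p.1.1 ≤ K ∧ (σ p.2).1 ∈ lossyVertices d σ K).card
      ≤ K ^ 2 * (lossyVertices d σ K).card := by
    refine card_le_mul_sq_of_injOn K (fun p => (σ p.2, p.1)) ?_ ?_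
    · intro p hp
      simp only [Finset.mem_filter, Finset.mem_univ, true_and] at hp
      exact ⟨hp.2.2, hp.2.1⟩
    · intro p hp q hq h h'
      simp only [Finset.mem_filter, Finset.mem_univ, true_and] at hp hq h h'
      have h := σ.injective h
      exact Prod.ext (stub_ext (by rw [hp.1, hq.1, h]) h') h
  rw [lossyPairs]
  refine (Finset.card_union_le _ _).trans ?_
  have := Finset.card_union_le (Finset.univ.filter fun p : Stub d × Stub d =>
      p.1.1 = p.2.1 ∧ d p.1.1 ≤ K ∧ (σ p.1).1 ∈ lossyVertices d σ K)
    (Finset.univ.filter fun p : Stub d × Stub d =>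
      p.1.1 = p.2.1 ∧ d p.1.1 ≤ K ∧ (σ p.2).1 ∈ lossyVertices d σ K)
  linarith

/-- If the centre and both ends are small and lossless, erased and original degrees agree and the
wedge is capped. If the centre is small and lossless but an end is large, the chain d(v) = D(v) ≤
D(w) ≤ d(w), with D the erased degree, puts it in the tail. -/
theorem bucketWedges_subset (K : ℕ) :
    bucketWedges d σ ⊆ (stubWedges d σ (CapOrdered K) ∪ (stubWedges d σ (TailOrdered K) ∪
      (lossyPairs d σ K ∪ halvedPairs d σ K))).image
        fun p => (p.1.1, (σ p.1).1, (σ p.2).1) := by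
  rintro ⟨v, w, w'⟩ h
  simp only [bucketWedges, erasedBucket, Finset.mem_filter, Finset.mem_univ, true_and,
    mem_erasedNbrs] at h
  obtain ⟨⟨⟨h1, i, rfl⟩, h2⟩, ⟨⟨h3, j, rfl⟩, h4⟩, h5⟩ := h
  refine Finset.mem_image.2 ⟨(⟨v, i⟩, ⟨v, j⟩), ?_, rfl⟩
  have hij : (⟨v, i⟩ : Stub d) ≠ ⟨v, j⟩ := fun e => h5 (by rw [e])
  have hv := erasedDegree_le (d := d) (σ := σ) v
  have hw := erasedDegree_le (d := d) (σ := σ) (σ ⟨v, i⟩).1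
  have hw' := erasedDegree_le (d := d) (σ := σ) (σ ⟨v, j⟩).1
  simp only [Finset.mem_union, stubWedges, lossyPairs, lossyVertices, halvedPairs,
    Finset.mem_filter, Finset.mem_univ, true_and]
  set w := (σ ⟨v, i⟩).1
  set w' := (σ ⟨v, j⟩).1
  by_cases hK : d v ≤ K
  · by_cases hlv : erasedDegree d σ v = d v
    · by_cases hwK : d w ≤ K ∧ d w' ≤ K
      · by_cases hlw : erasedDegree d σ w = d w ∧ erasedDegree d σ w' = d w'
        · left
          exact ⟨⟨hij, rfl, h1, h3, h5⟩, by omega, by omega, hK, hwK⟩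
        · right; right; left; right
          rcases not_and_or.1 hlw with h | h
          · left; exact ⟨hK, h, hwK.1⟩
          · right; exact ⟨hK, h, hwK.2⟩
      · right; left
        exact ⟨⟨hij, rfl, h1, h3, h5⟩, by omega, by omega, by omega⟩
    · right; right; left; left
      exact ⟨hlv, hK⟩
  -- For a large centre that is not halved, d(v) ≤ 2D(v) ≤ 2D(w) ≤ 2d(w); this is the factor 2 in
  -- `TailOrdered`.
  · by_cases hh : 2 * erasedDegree d σ v < d v
    · right; right; right
      exact ⟨hh, by omega⟩
    · right; left
      exact ⟨⟨hij, rfl, h1, h3, h5⟩, by omega, by omega, by omega⟩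

theorem card_bucketWedges_le (K : ℕ) :
    (bucketWedges d σ).card ≤ (stubWedges d σ (CapOrdered K)).card +
      (stubWedges d σ (TailOrdered K)).card + 3 * K ^ 2 * (lossyVertices d σ K).card +
      (halvedPairs d σ K).card := by
  have h1 := (Finset.card_le_card (bucketWedges_subset (d := d) (σ := σ) K)).trans
    Finset.card_image_le
  have h2 := Finset.card_union_le (stubWedges d σ (CapOrdered K)) (stubWedges d σ (TailOrdered K) ∪
      (lossyPairs d σ K ∪ halvedPairs d σ K))
  have h3 := Finset.card_union_le (stubWedges d σ (TailOrdered K))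
      (lossyPairs d σ K ∪ halvedPairs d σ K)
  have h4 := Finset.card_union_le (lossyPairs d σ K) (halvedPairs d σ K)
  have h5 := card_lossyPairs_le (d := d) (σ := σ) K
  omega

theorem card_stubWedges_le (K : ℕ) :
    (stubWedges d σ (CapOrdered K)).card ≤ (bucketWedges d σ).card +
      3 * K ^ 2 * (lossyVertices d σ K).card := by
  have h1 : (stubWedges d σ (CapOrdered K) \ lossyPairs d σ K).card ≤ (bucketWedges d σ).card := by
    refine Finset.card_le_card_of_injOn (fun p => (p.1.1, (σ p.1).1, (σ p.2).1)) ?_ ?_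
    · rintro ⟨⟨v, i⟩, ⟨v', j⟩⟩ h
      simp only [Finset.coe_sdiff, Set.mem_sdiff, Finset.mem_coe, Finset.mem_union, stubWedges,
        lossyPairs, lossyVertices, Finset.mem_filter, Finset.mem_univ, true_and, not_or,
        not_and_or, not_not] at h
      obtain ⟨⟨⟨h1, hvv, h2, h3, h4⟩, h5⟩, h6⟩ := h
      change v = v' at hvv
      subst hvv
      simp only [bucketWedges, erasedBucket, Finset.coe_filter, Finset.mem_filter, Finset.mem_univ,
        true_and, Set.mem_ofPred_eq, mem_erasedNbrs]
      simp only [not_true_eq_false, false_or] at h6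
      exact ⟨⟨⟨h2, i, rfl⟩, by omega⟩, ⟨⟨h3, j, rfl⟩, by omega⟩, h4⟩
    · rintro ⟨⟨v, i⟩, ⟨v', j⟩⟩ h ⟨⟨w, i'⟩, ⟨w', j'⟩⟩ h' e
      simp only [Finset.coe_sdiff, Set.mem_sdiff, Finset.mem_coe, Finset.mem_union, stubWedges,
        lossyPairs, lossyVertices, Finset.mem_filter, Finset.mem_univ, true_and, not_or,
        not_and_or, not_not] at h h'
      obtain ⟨⟨⟨h1, rfl, h2, h3, h4⟩, h5⟩, h6⟩ := h
      obtain ⟨⟨⟨-, rfl, -⟩, -⟩, -⟩ := h'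
      simp only [Prod.mk.injEq] at e
      obtain ⟨rfl, e1, e2⟩ := e
      have hv : erasedDegree d σ v = d v := by
        rcases h6.1 with h | h | h
        · exact absurd rfl h
        · exact h
        · exact absurd h5.2.2.1 h
      have hinj := stubColor_injective_of_erasedDegree_eq hv
      rw [hinj e1, hinj e2]
  have h2 := Finset.le_card_sdiff (lossyPairs d σ K) (stubWedges d σ (CapOrdered K))
  have h3 := card_lossyPairs_le (d := d) (σ := σ) K
  omega

theorem card_halvedPairs_le {K : ℕ} (hK : 16 ≤ K) :
    (halvedPairs d σ K).card ≤
      ∑ v, (4 * (d v * loopCount d σ v) + 32 * quadCount d σ v) := by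
  rw [Finset.card_eq_sum_card_fiberwise (f := fun p : Stub d × Stub d => p.1.1) (t := Finset.univ)
      (by intro; simp)]
  refine Finset.sum_le_sum fun v _ => ?_
  by_cases h : 2 * erasedDegree d σ v < d v ∧ K < d v
  · refine le_trans ?_ (sq_le_of_two_mul_erasedDegree_lt h.1 (by omega))
    calc _ ≤ (Finset.univ.image fun q : Fin (d v) × Fin (d v) =>
          ((⟨v, q.1⟩, ⟨v, q.2⟩) : Stub d × Stub d)).card := by
          refine Finset.card_le_card ?_
          rintro ⟨⟨a, i⟩, ⟨b, j⟩⟩ hp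
          simp only [halvedPairs, Finset.mem_filter, Finset.mem_univ, true_and] at hp
          obtain ⟨⟨rfl, -⟩, rfl⟩ := hp
          exact Finset.mem_image.2 ⟨(i, j), Finset.mem_univ _, rfl⟩
      _ ≤ _ := Finset.card_image_le
      _ = _ := by simp [sq]
  · rw [Finset.card_eq_zero.2]
    · exact Nat.zero_le _
    · rw [Finset.filter_eq_empty_iff]
      rintro p hp rfl
      simp only [halvedPairs, Finset.mem_filter, Finset.mem_univ, true_and] at hp
      exact h hp.2

theorem card_lossyVertices_le (K : ℕ) :
    (lossyVertices d σ K).card ≤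
      ∑ v, if d v ≤ K then loopCount d σ v + doubleCount d σ v else 0 := by
  rw [lossyVertices, Finset.card_filter]
  refine Finset.sum_le_sum fun v _ => ?_
  by_cases h1 : d v ≤ K
  · by_cases h2 : erasedDegree d σ v = d v
    · simp [h2]
    · simpa [h1, h2] using one_le_loopCount_add_doubleCount h2
  · simp [h1]

end Sandwich

/-! ### Averages over the matching for fixed degrees -/

section ConditionalAverages

variable {n : ℕ} (d : Fin n → ℕ)

/-- The pairs of stubs of one vertex other than `v`. -/
def stubPairsAway (v : Fin n) : Finset (Stub d × Stub d) :=
  Finset.univ.filter fun q => q.1.1 = q.2.1 ∧ q.1.1 ≠ v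

/-- The number of stub quadruples forming a wedge with degrees satisfying `R`. -/
noncomputable def wedgeWeight (R : ℕ → ℕ → ℕ → Prop) [∀ a b c, Decidable (R a b c)] : ℝ :=
  ∑ v, ∑ w, ∑ w', if (w ≠ v ∧ w' ≠ v ∧ w ≠ w') ∧ R (d v) (d w) (d w') then
    (d v : ℝ) * ((d v : ℝ) - 1) * d w * d w' else 0

variable {d}

theorem sum_stub {M : Type*} [AddCommMonoid M] (h : Fin n → M) :
    ∑ s : Stub d, h s.1 = ∑ v, d v • h v := by
  rw [Fintype.sum_sigma]
  simp

theorem card_stubPairsAway (v : Fin n) :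
    (stubPairsAway d v).card = ∑ x, if x ≠ v then d x ^ 2 else 0 := by
  rw [stubPairsAway, Finset.card_filter, Fintype.sum_prod_type]
  have h1 : ∀ s : Stub d, (∑ s' : Stub d, if s.1 = s'.1 ∧ s.1 ≠ v then 1 else 0) =
      if s.1 ≠ v then d s.1 else 0 := by
    intro s
    rw [sum_stub (fun x => if s.1 = x ∧ s.1 ≠ v then 1 else 0)]
    by_cases h : s.1 = v <;> simp [h]
  rw [Finset.sum_congr rfl fun s _ => h1 s, sum_stub (fun x => if x ≠ v then d x else 0)]
  refine Finset.sum_congr rfl fun x _ => ?_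
  split_ifs <;> simp [sq]

theorem sum_stub_pairs (h : Fin n → ℝ) :
    (∑ s : Stub d, ∑ s' : Stub d, if s ≠ s' ∧ s.1 = s'.1 then h s.1 else 0)
      = ∑ v, (d v : ℝ) * ((d v : ℝ) - 1) * h v := by
  have h1 : ∀ s : Stub d, (∑ s' : Stub d, if s ≠ s' ∧ s.1 = s'.1 then h s.1 else 0) =
      ((d s.1 : ℝ) - 1) * h s.1 := by
    intro s
    have h2 : (∑ s' : Stub d, if s.1 = s'.1 then h s.1 else 0) = d s.1 * h s.1 := by
      rw [sum_stub (fun x => if s.1 = x then h s.1 else 0)]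
      simp
    rw [← Finset.add_sum_erase _ _ (Finset.mem_univ s)] at h2 ⊢
    simp only [if_true, ne_eq, not_true_eq_false, false_and, if_false, zero_add] at h2 ⊢
    rw [sub_mul, one_mul, ← h2, add_sub_cancel_left]
    refine Finset.sum_congr rfl fun s' hs' => ?_
    have := (Finset.ne_of_mem_erase hs').symm
    simp [this]
  rw [Finset.sum_congr rfl fun s _ => h1 s, sum_stub (fun v => ((d v : ℝ) - 1) * h v)]
  refine Finset.sum_congr rfl fun v _ => ?_
  rw [nsmul_eq_mul]
  ring

theorem sum_stubWedge (R : ℕ → ℕ → ℕ → Prop) [∀ a b c, Decidable (R a b c)] :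
    (∑ s : Stub d, ∑ s' : Stub d, ∑ u : Stub d, ∑ u' : Stub d,
      if IsStubWedge s s' u u' ∧ R (d s.1) (d u.1) (d u'.1) then (1 : ℝ) else 0)
      = wedgeWeight d R := by
  have h1 : ∀ s s' : Stub d, (∑ u : Stub d, ∑ u' : Stub d,
      if IsStubWedge s s' u u' ∧ R (d s.1) (d u.1) (d u'.1) then (1 : ℝ) else 0) =
      if s ≠ s' ∧ s.1 = s'.1 then
        (∑ w, ∑ w', if (w ≠ s.1 ∧ w' ≠ s.1 ∧ w ≠ w') ∧ R (d s.1) (d w) (d w') then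
          (d w : ℝ) * d w' else 0) else 0 := by
    intro s s'
    by_cases h : s ≠ s' ∧ s.1 = s'.1
    · rw [if_pos h]
      have h2 : ∀ u : Stub d, (∑ u' : Stub d,
          if IsStubWedge s s' u u' ∧ R (d s.1) (d u.1) (d u'.1) then (1 : ℝ) else 0) =
          ∑ w', if (u.1 ≠ s.1 ∧ w' ≠ s.1 ∧ u.1 ≠ w') ∧ R (d s.1) (d u.1) (d w') then
            (d w' : ℝ) else 0 := by
        intro u
        have h3 := sum_stub (d := d) (fun w' => if (u.1 ≠ s.1 ∧ w' ≠ s.1 ∧ u.1 ≠ w') ∧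
          R (d s.1) (d u.1) (d w') then (1 : ℝ) else 0)
        simp only [nsmul_eq_mul, mul_ite, mul_one, mul_zero] at h3
        rw [← h3]
        refine Finset.sum_congr rfl fun u' _ => ?_
        refine if_congr ?_ rfl rfl
        simp only [IsStubWedge]
        tauto
      rw [Finset.sum_congr rfl fun u _ => h2 u, sum_stub (d := d) (fun w => ∑ w',
        if (w ≠ s.1 ∧ w' ≠ s.1 ∧ w ≠ w') ∧ R (d s.1) (d w) (d w') then (d w' : ℝ) else 0)]
      refine Finset.sum_congr rfl fun w _ => ?_
      rw [nsmul_eq_mul, Finset.mul_sum]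
      refine Finset.sum_congr rfl fun w' _ => ?_
      rw [mul_ite, mul_zero]
    · rw [if_neg h]
      refine Finset.sum_eq_zero fun u _ => Finset.sum_eq_zero fun u' _ => ?_
      rw [if_neg]
      rintro ⟨⟨h2, h3, -⟩, -⟩
      exact h ⟨h2, h3⟩
  rw [Finset.sum_congr rfl fun s _ => Finset.sum_congr rfl fun s' _ => h1 s s',
    sum_stub_pairs (fun v => ∑ w, ∑ w', if (w ≠ v ∧ w' ≠ v ∧ w ≠ w') ∧ R (d v) (d w) (d w') then
          (d w : ℝ) * d w' else 0), wedgeWeight]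
  refine Finset.sum_congr rfl fun v _ => ?_
  rw [Finset.mul_sum]
  refine Finset.sum_congr rfl fun w _ => ?_
  rw [Finset.mul_sum]
  refine Finset.sum_congr rfl fun w' _ => ?_
  rw [mul_ite, mul_zero]
  refine if_congr Iff.rfl ?_ rfl
  ring

theorem matchAvg_card_stubWedges (R : ℕ → ℕ → ℕ → Prop) [∀ a b c, Decidable (R a b c)] :
    matchAvg d (fun σ => ((stubWedges d σ R).card : ℝ)) =
    ∑ s : Stub d, ∑ s' : Stub d, ∑ u : Stub d, ∑ u' : Stub d,
      if IsStubWedge s s' u u' ∧ R (d s.1) (d u.1) (d u'.1) then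
        matchAvg d (fun σ => if σ s = u ∧ σ s' = u' then 1 else 0) else 0 := by
  have h1 : ∀ σ : Equiv.Perm (Stub d), ((stubWedges d σ R).card : ℝ) =
      ∑ s : Stub d, ∑ s' : Stub d, ∑ u : Stub d, ∑ u' : Stub d,
      (if IsStubWedge s s' u u' ∧ R (d s.1) (d u.1) (d u'.1) then 1 else 0) *
        (if σ s = u ∧ σ s' = u' then 1 else 0) := by
    intro σ
    rw [stubWedges, Finset.card_filter, Fintype.sum_prod_type]
    push_cast
    refine Finset.sum_congr rfl fun s _ => Finset.sum_congr rfl fun s' _ => ?_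
    rw [Finset.sum_eq_single (σ s), Finset.sum_eq_single (σ s')]
    · simp
    · intro u' _ hu'
      simp [hu'.symm]
    · simp
    · intro u _ hu
      refine Finset.sum_eq_zero fun u' _ => ?_
      simp [hu.symm]
    · simp
  simp only [h1, matchAvg_sum, matchAvg_const_mul]
  refine Finset.sum_congr rfl fun s _ => Finset.sum_congr rfl fun s' _ =>
    Finset.sum_congr rfl fun u _ => Finset.sum_congr rfl fun u' _ => ?_
  rw [ite_mul, one_mul, zero_mul]

theorem IsStubWedge.nodup {s s' u u' : Stub d} (h : IsStubWedge s s' u u') :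
    ([s, s', u, u'] : List (Stub d)).Nodup := by
  obtain ⟨h1, h2, h3, h4, h5⟩ := h
  have e1 : s ≠ u := fun e => h3 (by rw [e])
  have e2 : s ≠ u' := fun e => h4 (by rw [e])
  have e3 : s' ≠ u := fun e => h3 (by rw [h2, e])
  have e4 : s' ≠ u' := fun e => h4 (by rw [h2, e])
  have e5 : u ≠ u' := fun e => h5 (by rw [e])
  simp [h1, e1, e2, e3, e4, e5]

theorem matchAvg_stubWedges_le (R : ℕ → ℕ → ℕ → Prop) [∀ a b c, Decidable (R a b c)]
    (hm : 4 ≤ Fintype.card (Stub d)) :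
    matchAvg d (fun σ => ((stubWedges d σ R).card : ℝ)) ≤ wedgeWeight d R *
      (1 / (((Fintype.card (Stub d) : ℝ) - 1) * ((Fintype.card (Stub d) : ℝ) - 3))) := by
  rw [matchAvg_card_stubWedges, ← sum_stubWedge]
  simp only [Finset.sum_mul]
  refine Finset.sum_le_sum fun s _ => Finset.sum_le_sum fun s' _ =>
    Finset.sum_le_sum fun u _ => Finset.sum_le_sum fun u' _ => ?_
  split_ifs with h
  · rw [one_mul]
    exact matchAvg_pair_le h.1.nodup hm
  · simp

theorem le_matchAvg_stubWedges (R : ℕ → ℕ → ℕ → Prop) [∀ a b c, Decidable (R a b c)]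
    (hm : 4 ≤ Fintype.card (Stub d)) :
    wedgeWeight d R * (1 / ((Fintype.card (Stub d) : ℝ) * (Fintype.card (Stub d) : ℝ))) ≤
    matchAvg d (fun σ => ((stubWedges d σ R).card : ℝ)) := by
  rw [matchAvg_card_stubWedges, ← sum_stubWedge]
  simp only [Finset.sum_mul]
  refine Finset.sum_le_sum fun s _ => Finset.sum_le_sum fun s' _ =>
    Finset.sum_le_sum fun u _ => Finset.sum_le_sum fun u' _ => ?_
  split_ifs with h
  · rw [one_mul]
    exact le_matchAvg_pair h.1.nodup hm
  · simp

theorem matchAvg_loopCount_le (v : Fin n) (hm : 4 ≤ Fintype.card (Stub d)) :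
    matchAvg d (fun σ => (loopCount d σ v : ℝ)) ≤
      (d v : ℝ) ^ 2 * (2 / (Fintype.card (Stub d) : ℝ)) := by
  have h1 : ∀ σ : Equiv.Perm (Stub d), (loopCount d σ v : ℝ) ≤
      ∑ i : Fin (d v), ∑ j : Fin (d v), if σ ⟨v, i⟩ = ⟨v, j⟩ then 1 else 0 := by
    intro σ
    rw [loopCount, Finset.card_filter]
    push_cast
    refine Finset.sum_le_sum fun i _ => ?_
    split_ifs with h
    · rw [stubColor] at h
      obtain ⟨j, hj⟩ : ∃ j : Fin (d v), σ ⟨v, i⟩ = ⟨v, j⟩ := by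
        generalize σ ⟨v, i⟩ = t at h
        obtain ⟨w, j⟩ := t
        obtain rfl : w = v := h
        exact ⟨j, rfl⟩
      simp [hj]
    · exact Finset.sum_nonneg fun j _ => by split_ifs <;> simp
  refine (matchAvg_mono fun σ _ => h1 σ).trans ?_
  simp only [matchAvg_sum]
  calc _ ≤ ∑ i : Fin (d v), ∑ j : Fin (d v), 2 / (Fintype.card (Stub d) : ℝ) :=
        Finset.sum_le_sum fun i _ => Finset.sum_le_sum fun j _ => matchAvg_apply_eq_le _ _ hm
    _ = _ := by simp; ring

/-- Union bound over the two stubs at v and over their two targets, which share a vertex other than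
v. Equal targets are included harmlessly. -/
theorem matchAvg_doubleCount_le (v : Fin n) (hm : 8 ≤ Fintype.card (Stub d)) :
    matchAvg d (fun σ => (doubleCount d σ v : ℝ)) ≤
      (d v : ℝ) ^ 2 * (stubPairsAway d v).card * (2 / (Fintype.card (Stub d) : ℝ)) ^ 2 := by
  have h1 : ∀ σ : Equiv.Perm (Stub d), (doubleCount d σ v : ℝ) ≤
      ∑ p : Fin (d v) × Fin (d v), ∑ q ∈ stubPairsAway d v,
        (if p.1 ≠ p.2 then 1 else 0) *
          if ∀ r ∈ [((⟨v, p.1⟩ : Stub d), q.1), (⟨v, p.2⟩, q.2)], σ r.1 = r.2 then 1 else 0 := by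
    intro σ
    rw [doubleCount, Finset.card_filter]
    push_cast
    refine Finset.sum_le_sum fun p _ => ?_
    by_cases h : p.1 ≠ p.2 ∧ stubColor d σ v p.1 = stubColor d σ v p.2 ∧ stubColor d σ v p.1 ≠ v
    · rw [if_pos h]
      have hq : (σ ⟨v, p.1⟩, σ ⟨v, p.2⟩) ∈ stubPairsAway d v := by
        simp only [stubPairsAway, Finset.mem_filter, Finset.mem_univ, true_and]
        exact h.2
      refine le_trans ?_ (Finset.single_le_sum (fun q _ => ?_) hq)
      · simp [h.1]
      · split_ifs <;> simp
    · rw [if_neg h]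
      exact Finset.sum_nonneg fun q _ => by split_ifs <;> simp
  refine (matchAvg_mono fun σ _ => h1 σ).trans ?_
  simp only [matchAvg_sum, matchAvg_const_mul]
  calc _ ≤ ∑ p : Fin (d v) × Fin (d v), ∑ q ∈ stubPairsAway d v,
        (2 / (Fintype.card (Stub d) : ℝ)) ^ 2 := by
        refine Finset.sum_le_sum fun p _ => Finset.sum_le_sum fun q hq => ?_
        simp only [stubPairsAway, Finset.mem_filter, Finset.mem_univ, true_and] at hq
        split_ifs with hp
        · rw [one_mul]
          refine matchAvg_ite_le _ (by simpa using hp) ?_ (by simpa using hm) (by omega)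
          have e1 : ∀ i, (⟨v, i⟩ : Stub d) ≠ q.1 := fun i e => hq.2 (by rw [← e])
          have e2 : ∀ i, (⟨v, i⟩ : Stub d) ≠ q.2 := fun i e => hq.2 (by rw [hq.1, ← e])
          simp only [List.mem_cons, List.not_mem_nil, or_false]
          rintro _ (rfl | rfl) _ (rfl | rfl)
          all_goals first | exact e1 _ | exact e2 _
        · rw [zero_mul]; positivity
    _ = _ := by simp; ring

/-- The same union bound with four distinct stubs at v. The two pairs of targets are summed
independently, overlaps included, which produces the square of the number of pairs. -/
theorem matchAvg_quadCount_le (v : Fin n) (hm : 16 ≤ Fintype.card (Stub d)) :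
    matchAvg d (fun σ => (quadCount d σ v : ℝ)) ≤
      (d v : ℝ) ^ 4 * ((stubPairsAway d v).card : ℝ) ^ 2 *
        (2 / (Fintype.card (Stub d) : ℝ)) ^ 4 := by
  have h1 : ∀ σ : Equiv.Perm (Stub d), (quadCount d σ v : ℝ) ≤
      ∑ p : (Fin (d v) × Fin (d v)) × (Fin (d v) × Fin (d v)),
        ∑ q ∈ stubPairsAway d v, ∑ q' ∈ stubPairsAway d v,
        (if ([p.1.1, p.1.2, p.2.1, p.2.2] : List (Fin (d v))).Nodup then 1 else 0) *
          if ∀ r ∈ [((⟨v, p.1.1⟩ : Stub d), q.1), (⟨v, p.1.2⟩, q.2), (⟨v, p.2.1⟩, q'.1),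
            (⟨v, p.2.2⟩, q'.2)], σ r.1 = r.2 then 1 else 0 := by
    intro σ
    rw [quadCount, Finset.card_filter]
    push_cast
    refine Finset.sum_le_sum fun p _ => ?_
    by_cases h : ([p.1.1, p.1.2, p.2.1, p.2.2] : List (Fin (d v))).Nodup ∧
      (stubColor d σ v p.1.1 = stubColor d σ v p.1.2 ∧ stubColor d σ v p.1.1 ≠ v) ∧
      (stubColor d σ v p.2.1 = stubColor d σ v p.2.2 ∧ stubColor d σ v p.2.1 ≠ v)
    · rw [if_pos h]
      have hq : (σ ⟨v, p.1.1⟩, σ ⟨v, p.1.2⟩) ∈ stubPairsAway d v := by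
        simp only [stubPairsAway, Finset.mem_filter, Finset.mem_univ, true_and]
        exact h.2.1
      have hq' : (σ ⟨v, p.2.1⟩, σ ⟨v, p.2.2⟩) ∈ stubPairsAway d v := by
        simp only [stubPairsAway, Finset.mem_filter, Finset.mem_univ, true_and]
        exact h.2.2
      refine le_trans ?_ (Finset.single_le_sum (fun q _ => Finset.sum_nonneg fun q' _ => ?_) hq)
      · refine le_trans ?_ (Finset.single_le_sum (fun q _ => ?_) hq')
        · rw [if_pos h.1]
          simp
        · split_ifs <;> simp
      · split_ifs <;> simp
    · rw [if_neg h]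
      exact Finset.sum_nonneg fun q _ => Finset.sum_nonneg fun q' _ => by split_ifs <;> simp
  refine (matchAvg_mono fun σ _ => h1 σ).trans ?_
  simp only [matchAvg_sum, matchAvg_const_mul]
  calc _ ≤ ∑ p : (Fin (d v) × Fin (d v)) × (Fin (d v) × Fin (d v)),
        ∑ q ∈ stubPairsAway d v, ∑ q' ∈ stubPairsAway d v,
        (2 / (Fintype.card (Stub d) : ℝ)) ^ 4 := by
        refine Finset.sum_le_sum fun p _ => Finset.sum_le_sum fun q hq =>
          Finset.sum_le_sum fun q' hq' => ?_
        simp only [stubPairsAway, Finset.mem_filter, Finset.mem_univ, true_and] at hq hq'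
        split_ifs with hp
        · rw [one_mul]
          refine matchAvg_ite_le _ ?_ ?_ (by simpa using hm) (by omega)
          · have := hp.map (f := fun i => (⟨v, i⟩ : Stub d)) (fun i j h => by simpa using h)
            simpa using this
          · have e1 : ∀ i, (⟨v, i⟩ : Stub d) ≠ q.1 := fun i e => hq.2 (by rw [← e])
            have e2 : ∀ i, (⟨v, i⟩ : Stub d) ≠ q.2 := fun i e => hq.2 (by rw [hq.1, ← e])
            have e3 : ∀ i, (⟨v, i⟩ : Stub d) ≠ q'.1 := fun i e => hq'.2 (by rw [← e])
            have e4 : ∀ i, (⟨v, i⟩ : Stub d) ≠ q'.2 := fun i e => hq'.2 (by rw [hq'.1, ← e])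
            simp only [List.mem_cons, List.not_mem_nil, or_false]
            rintro _ (rfl | rfl | rfl | rfl) _ (rfl | rfl | rfl | rfl)
            all_goals first | exact e1 _ | exact e2 _ | exact e3 _ | exact e4 _
        · rw [zero_mul]; positivity
    _ = _ := by simp; ring

end ConditionalAverages

/-! ### Expectations over independent degrees -/

/-- The expectation of `F` over `n` independent draws from the weights `p` on `S`. -/
noncomputable def prodExp (S : Finset ℕ) (p : ℕ → ℝ) {n : ℕ} (F : (Fin n → ℕ) → ℝ) : ℝ :=
  ∑ d ∈ Fintype.piFinset fun _ : Fin n => S, (∏ i, p (d i)) * F d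

section ProductExpectation

variable {S : Finset ℕ} {p : ℕ → ℝ} {n : ℕ}

theorem prodExp_mono (hp : ∀ t ∈ S, 0 ≤ p t) {F G : (Fin n → ℕ) → ℝ}
    (h : ∀ d, (∀ i, d i ∈ S) → F d ≤ G d) : prodExp S p F ≤ prodExp S p G := by
  refine Finset.sum_le_sum fun d hd => ?_
  rw [Fintype.mem_piFinset] at hd
  exact mul_le_mul_of_nonneg_left (h d hd) (Finset.prod_nonneg fun i _ => hp _ (hd i))

theorem prodExp_congr {F G : (Fin n → ℕ) → ℝ}
    (h : ∀ d, (∀ i, d i ∈ S) → F d = G d) : prodExp S p F = prodExp S p G := by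
  refine Finset.sum_congr rfl fun d hd => ?_
  rw [Fintype.mem_piFinset] at hd
  rw [h d hd]

theorem prodExp_add (F G : (Fin n → ℕ) → ℝ) :
    prodExp S p (fun d => F d + G d) = prodExp S p F + prodExp S p G := by
  simp [prodExp, mul_add, Finset.sum_add_distrib]

theorem prodExp_sub (F G : (Fin n → ℕ) → ℝ) :
    prodExp S p (fun d => F d - G d) = prodExp S p F - prodExp S p G := by
  simp [prodExp, mul_sub, Finset.sum_sub_distrib]

theorem prodExp_const_mul (c : ℝ) (F : (Fin n → ℕ) → ℝ) :
    prodExp S p (fun d => c * F d) = c * prodExp S p F := by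
  simp only [prodExp, Finset.mul_sum]
  exact Finset.sum_congr rfl fun d _ => by ring

theorem prodExp_sum {ι : Type*} (s : Finset ι) (F : ι → (Fin n → ℕ) → ℝ) :
    prodExp S p (fun d => ∑ i ∈ s, F i d) = ∑ i ∈ s, prodExp S p (F i) := by
  simp only [prodExp, Finset.mul_sum]
  exact Finset.sum_comm

theorem prodExp_prod (g : Fin n → ℕ → ℝ) :
    prodExp S p (fun d => ∏ i, g i (d i)) = ∏ i, ∑ t ∈ S, p t * g i t := by
  rw [prodExp, Finset.prod_univ_sum]
  exact Finset.sum_congr rfl fun d _ => by rw [Finset.prod_mul_distrib]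

theorem prodExp_const (h1 : ∑ t ∈ S, p t = 1) (c : ℝ) :
    prodExp S p (fun _ : Fin n → ℕ => c) = c := by
  have h := prodExp_prod (S := S) (p := p) (n := n) (fun _ _ => 1)
  simp only [Finset.prod_const_one, mul_one, h1] at h
  have h2 := prodExp_const_mul (S := S) (p := p) (n := n) c (fun _ => 1)
  rw [h] at h2
  simpa using h2

/-- The indicator that three distinct coordinates take the values a, b, c is a product over
coordinates, so its expectation factors; G is a linear combination of such indicators. -/
theorem prodExp_triple (h1 : ∑ t ∈ S, p t = 1) {v w w' : Fin n} (hvw : w ≠ v) (hvw' : w' ≠ v)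
    (hww' : w ≠ w') (G : ℕ → ℕ → ℕ → ℝ) :
    prodExp S p (fun d => G (d v) (d w) (d w')) =
      ∑ a ∈ S, ∑ b ∈ S, ∑ c ∈ S, p a * p b * p c * G a b c := by
  have h : ∀ a ∈ S, ∀ b ∈ S, ∀ c ∈ S, prodExp S p (fun d : Fin n → ℕ => ∏ i,
      (if i = v then (if d i = a then 1 else 0) else 1) *
      (if i = w then (if d i = b then 1 else 0) else 1) *
      (if i = w' then (if d i = c then 1 else 0) else 1)) = p a * p b * p c := by
    intro a ha b hb c hc
    rw [prodExp_prod (fun i t => (if i = v then (if t = a then (1 : ℝ) else 0) else 1) *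
      (if i = w then (if t = b then 1 else 0) else 1) *
      (if i = w' then (if t = c then 1 else 0) else 1))]
    calc _ = ∏ i, (if i = v then p a else 1) * (if i = w then p b else 1) *
          (if i = w' then p c else 1) := by
          refine Finset.prod_congr rfl fun i _ => ?_
          by_cases e1 : i = v
          · subst e1
            simp [hvw.symm, hvw'.symm, ha]
          · by_cases e2 : i = w
            · subst e2
              simp [hvw, hww', hb]
            · by_cases e3 : i = w'
              · subst e3
                simp [e1, e2, hc]
              · simp [e1, e2, e3, h1]
      _ = _ := by simp only [Finset.prod_mul_distrib]; simp
  calc _ = prodExp S p (fun d : Fin n → ℕ => ∑ a ∈ S, ∑ b ∈ S, ∑ c ∈ S, G a b c * ∏ i,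
      ((if i = v then (if d i = a then 1 else 0) else 1) *
      (if i = w then (if d i = b then 1 else 0) else 1) *
      (if i = w' then (if d i = c then 1 else 0) else 1))) := by
        refine prodExp_congr fun d hd => ?_
        simp only [Finset.prod_mul_distrib]
        simp [hd]
    _ = _ := by
        simp only [prodExp_sum, prodExp_const_mul]
        refine Finset.sum_congr rfl fun a ha => Finset.sum_congr rfl fun b hb =>
          Finset.sum_congr rfl fun c hc => ?_
        rw [h a ha b hb c hc]
        ring

theorem prodExp_pair (h1 : ∑ t ∈ S, p t = 1) {v w : Fin n} (hvw : w ≠ v) (G : ℕ → ℕ → ℝ) :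
    prodExp S p (fun d => G (d v) (d w)) = ∑ a ∈ S, ∑ b ∈ S, p a * p b * G a b := by
  have h : ∀ a ∈ S, ∀ b ∈ S, prodExp S p (fun d : Fin n → ℕ => ∏ i,
      (if i = v then (if d i = a then 1 else 0) else 1) *
      (if i = w then (if d i = b then 1 else 0) else 1)) = p a * p b := by
    intro a ha b hb
    rw [prodExp_prod (fun i t => (if i = v then (if t = a then (1 : ℝ) else 0) else 1) *
      (if i = w then (if t = b then 1 else 0) else 1))]
    calc _ = ∏ i, (if i = v then p a else 1) * (if i = w then p b else 1) := by
          refine Finset.prod_congr rfl fun i _ => ?_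
          by_cases e1 : i = v
          · subst e1
            simp [hvw.symm, ha]
          · by_cases e2 : i = w
            · subst e2
              simp [hvw, hb]
            · simp [e1, e2, h1]
      _ = _ := by simp only [Finset.prod_mul_distrib]; simp
  calc _ = prodExp S p (fun d : Fin n → ℕ => ∑ a ∈ S, ∑ b ∈ S, G a b * ∏ i,
      ((if i = v then (if d i = a then 1 else 0) else 1) *
      (if i = w then (if d i = b then 1 else 0) else 1))) := by
        refine prodExp_congr fun d hd => ?_
        simp only [Finset.prod_mul_distrib]
        simp [hd]
    _ = _ := by
        simp only [prodExp_sum, prodExp_const_mul]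
        refine Finset.sum_congr rfl fun a ha => Finset.sum_congr rfl fun b hb => ?_
        rw [h a ha b hb]
        ring

theorem prodExp_single (h1 : ∑ t ∈ S, p t = 1) (v : Fin n) (G : ℕ → ℝ) :
    prodExp S p (fun d => G (d v)) = ∑ a ∈ S, p a * G a := by
  have h := prodExp_prod (S := S) (p := p) (fun i t => if i = v then G t else 1)
  simp only [Finset.prod_ite_eq', Finset.mem_univ, if_true] at h
  rw [h]
  calc _ = ∏ i, if i = v then ∑ a ∈ S, p a * G a else 1 := by
        refine Finset.prod_congr rfl fun i _ => ?_
        split_ifs <;> simp [h1]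
    _ = _ := by simp

theorem sum_distinct_triples (n : ℕ) (c : ℝ) :
    (∑ v : Fin n, ∑ w : Fin n, ∑ w' : Fin n, if w ≠ v ∧ w' ≠ v ∧ w ≠ w' then c else 0)
      = (n : ℝ) * ((n : ℝ) - 1) * ((n : ℝ) - 2) * c := by
  have h1 : ∀ v w : Fin n, (∑ w' : Fin n, if w ≠ v ∧ w' ≠ v ∧ w ≠ w' then c else 0) =
      if w ≠ v then ((n : ℝ) - 2) * c else 0 := by
    intro v w
    by_cases h : w = v
    · simp [h]
    · have h2 : (∑ w' : Fin n, if w ≠ v ∧ w' ≠ v ∧ w ≠ w' then c else 0)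
          = ∑ w' : Fin n, (c - (if w' = v then c else 0) - if w' = w then c else 0) := by
        refine Finset.sum_congr rfl fun w' _ => ?_
        by_cases e1 : w' = v
        · subst e1; simp [Ne.symm h]
        · by_cases e2 : w' = w
          · subst e2; simp [h]
          · simp [h, e1, e2, Ne.symm e2]
      rw [h2]
      simp only [Finset.sum_sub_distrib, Finset.sum_const, Finset.card_univ, Fintype.card_fin,
        nsmul_eq_mul, Finset.sum_ite_eq', Finset.mem_univ, if_true, ne_eq, h, not_false_eq_true]
      ring
  have h3 : ∀ v : Fin n, (∑ w : Fin n, if w ≠ v then ((n : ℝ) - 2) * c else 0) =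
      ((n : ℝ) - 1) * (((n : ℝ) - 2) * c) := by
    intro v
    have h4 : (∑ w : Fin n, if w ≠ v then ((n : ℝ) - 2) * c else 0) =
        ∑ w : Fin n, (((n : ℝ) - 2) * c - if w = v then ((n : ℝ) - 2) * c else 0) := by
      refine Finset.sum_congr rfl fun w _ => ?_
      by_cases e : w = v <;> simp [e]
    rw [h4]
    simp only [Finset.sum_sub_distrib, Finset.sum_const, Finset.card_univ, Fintype.card_fin,
        nsmul_eq_mul, Finset.sum_ite_eq', Finset.mem_univ, if_true]
    ring
  simp only [h1, h3, Finset.sum_const, Finset.card_univ, Fintype.card_fin, nsmul_eq_mul]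
  ring

theorem prodExp_wedgeWeight (h1 : ∑ t ∈ S, p t = 1) (R : ℕ → ℕ → ℕ → Prop)
    [∀ a b c, Decidable (R a b c)] :
    prodExp S p (fun d : Fin n → ℕ => wedgeWeight d R) =
      (n : ℝ) * ((n : ℝ) - 1) * ((n : ℝ) - 2) * ∑ a ∈ S, ∑ b ∈ S, ∑ c ∈ S, p a * p b * p c *
        if R a b c then (a : ℝ) * ((a : ℝ) - 1) * b * c else 0 := by
  rw [← sum_distinct_triples]
  simp only [wedgeWeight, prodExp_sum]
  refine Finset.sum_congr rfl fun v _ => Finset.sum_congr rfl fun w _ =>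
    Finset.sum_congr rfl fun w' _ => ?_
  by_cases h : w ≠ v ∧ w' ≠ v ∧ w ≠ w'
  · simp only [h, ne_eq, not_false_eq_true, true_and, and_self, if_true]
    exact prodExp_triple h1 h.1 h.2.1 h.2.2
      (fun a b c => if R a b c then (a : ℝ) * ((a : ℝ) - 1) * b * c else 0)
  · rw [if_neg h]
    simp only [h, false_and, if_false]
    exact prodExp_const h1 0

/-- Centred independent terms have vanishing cross products, and each variance is at most the second
moment. -/
theorem prodExp_sq_sum_sub_le (h1 : ∑ t ∈ S, p t = 1) :
    prodExp S p (fun d : Fin n → ℕ => (∑ i, ((d i : ℝ) - ∑ t ∈ S, p t * t)) ^ 2) ≤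
      n * ∑ t ∈ S, p t * (t : ℝ) ^ 2 := by
  generalize hν : ∑ t ∈ S, p t * (t : ℝ) = ν
  have h2 : ∀ i j : Fin n, prodExp S p (fun d : Fin n → ℕ => ((d i : ℝ) - ν) * ((d j : ℝ) - ν)) ≤
      if j = i then ∑ t ∈ S, p t * (t : ℝ) ^ 2 else 0 := by
    intro i j
    by_cases hij : j = i
    · subst hij
      rw [if_pos rfl, prodExp_single h1 j (fun t => ((t : ℝ) - ν) * ((t : ℝ) - ν))]
      have h3 : ∑ a ∈ S, p a * (((a : ℝ) - ν) * ((a : ℝ) - ν)) =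
          ∑ t ∈ S, p t * (t : ℝ) ^ 2 - 2 * ν * (∑ t ∈ S, p t * (t : ℝ)) +
            ν ^ 2 * ∑ t ∈ S, p t := by
        rw [Finset.mul_sum, Finset.mul_sum, ← Finset.sum_sub_distrib, ← Finset.sum_add_distrib]
        exact Finset.sum_congr rfl fun t _ => by ring
      rw [h3, h1, hν]
      nlinarith [sq_nonneg ν]
    · rw [if_neg hij, prodExp_pair h1 hij (fun a b => ((a : ℝ) - ν) * ((b : ℝ) - ν))]
      have h3 : ∑ a ∈ S, ∑ b ∈ S, p a * p b * (((a : ℝ) - ν) * ((b : ℝ) - ν)) =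
          (∑ a ∈ S, p a * ((a : ℝ) - ν)) * ∑ b ∈ S, p b * ((b : ℝ) - ν) := by
        rw [Finset.sum_mul_sum]
        exact Finset.sum_congr rfl fun a _ => Finset.sum_congr rfl fun b _ => by ring
      have h4 : ∑ a ∈ S, p a * ((a : ℝ) - ν) = 0 := by
        simp only [mul_sub, Finset.sum_sub_distrib]
        rw [← Finset.sum_mul, h1, hν]
        ring
      rw [h3, h4, zero_mul]
  simp only [sq (∑ i : Fin n, _), Finset.sum_mul_sum, prodExp_sum]
  calc _ ≤ ∑ i : Fin n, ∑ j : Fin n, if j = i then ∑ t ∈ S, p t * (t : ℝ) ^ 2 else 0 :=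
        Finset.sum_le_sum fun i _ => Finset.sum_le_sum fun j _ => h2 i j
    _ = _ := by simp

/-- A weak law in mean: the bias of the truncated law, a free threshold δ, and the variance divided
by δ. -/
theorem prodExp_abs_mean_sub_le (hp : ∀ t ∈ S, 0 ≤ p t) (h1 : ∑ t ∈ S, p t = 1) (hn : 0 < n)
    (μ : ℝ) {δ : ℝ} (hδ : 0 < δ) :
    prodExp S p (fun d : Fin n → ℕ => |(∑ i, (d i : ℝ)) / n - μ|) ≤
      |∑ t ∈ S, p t * t - μ| + δ + (∑ t ∈ S, p t * (t : ℝ) ^ 2) / (n * δ) := by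
  have hn' : (0 : ℝ) < n := by exact_mod_cast hn
  set ν := ∑ t ∈ S, p t * (t : ℝ) with hν
  calc _ ≤ prodExp S p (fun d : Fin n → ℕ => (|ν - μ| + δ) +
        (1 / (n ^ 2 * δ)) * (∑ i, ((d i : ℝ) - ν)) ^ 2) := by
        refine prodExp_mono hp fun d _ => ?_
        set X := ∑ i, ((d i : ℝ) - ν) with hX
        have hX' : (∑ i, (d i : ℝ)) / n - μ = X / n + (ν - μ) := by
          rw [hX, Finset.sum_sub_distrib]
          simp only [Finset.sum_const, Finset.card_univ, Fintype.card_fin, nsmul_eq_mul]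
          field_simp
          ring
        -- With y = |X/n| this is y ≤ δ + y²/δ, which replaces the Cauchy–Schwarz inequality and
        -- keeps the error linear in the variance.
        have h2 : |X / n| ≤ δ + 1 / (n ^ 2 * δ) * X ^ 2 := by
          have h3 : 1 / (n ^ 2 * δ) * X ^ 2 = |X / n| ^ 2 / δ := by
            rw [sq_abs, div_pow]
            field_simp
          rw [h3]
          have h4 : |X / n| ≤ δ + |X / n| ^ 2 / δ := by
            rw [← sub_nonneg]
            have : δ + |X / n| ^ 2 / δ - |X / n| = (δ ^ 2 + |X / n| ^ 2 - δ * |X / n|) / δ := by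
              field_simp
            rw [this]
            apply div_nonneg _ hδ.le
            nlinarith [sq_nonneg (δ - |X / n|), abs_nonneg (X / n)]
          exact h4
        rw [hX']
        have := abs_add_le (X / n) (ν - μ)
        linarith
    _ = (|ν - μ| + δ) + (1 / (n ^ 2 * δ)) *
        prodExp S p (fun d : Fin n → ℕ => (∑ i, ((d i : ℝ) - ν)) ^ 2) := by
        rw [prodExp_add, prodExp_const h1, prodExp_const_mul]
    _ ≤ (|ν - μ| + δ) + (1 / (n ^ 2 * δ)) * (n * ∑ t ∈ S, p t * (t : ℝ) ^ 2) := by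
        gcongr
        exact prodExp_sq_sum_sub_le h1
    _ = _ := by
        congr 1
        field_simp

end ProductExpectation

/-! ### Error bounds for a fixed degree sequence -/

section FixedDegrees

variable {n : ℕ} {d : Fin n → ℕ}

theorem le_card_stub (hd : ∀ i, 1 ≤ d i) : n ≤ Fintype.card (Stub d) := by
  rw [card_stub]
  calc n = ∑ _i : Fin n, 1 := by simp
    _ ≤ _ := Finset.sum_le_sum fun i _ => hd i

theorem wedgeWeight_nonneg (R : ℕ → ℕ → ℕ → Prop) [∀ a b c, Decidable (R a b c)] :
    0 ≤ wedgeWeight d R := by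
  refine Finset.sum_nonneg fun v _ => Finset.sum_nonneg fun w _ => Finset.sum_nonneg fun w' _ => ?_
  split_ifs
  · have : (0 : ℝ) ≤ (d v : ℝ) * ((d v : ℝ) - 1) := by
      rcases Nat.eq_zero_or_pos (d v) with h | h
      · simp [h]
      · have : (1 : ℝ) ≤ d v := by exact_mod_cast h
        apply mul_nonneg <;> linarith
    positivity
  · exact le_rfl

theorem wedgeWeight_capOrdered_le (K : ℕ) :
    wedgeWeight d (CapOrdered K) ≤ (n : ℝ) ^ 3 * (K : ℝ) ^ 4 := by
  calc _ ≤ ∑ v : Fin n, ∑ w : Fin n, ∑ w' : Fin n, (K : ℝ) ^ 4 := by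
        refine Finset.sum_le_sum fun v _ => Finset.sum_le_sum fun w _ =>
          Finset.sum_le_sum fun w' _ => ?_
        split_ifs with h
        · obtain ⟨-, -, -, h1, h2, h3⟩ := h
          have h1' : (d v : ℝ) ≤ K := by exact_mod_cast h1
          have h2' : (d w : ℝ) ≤ K := by exact_mod_cast h2
          have h3' : (d w' : ℝ) ≤ K := by exact_mod_cast h3
          calc (d v : ℝ) * ((d v : ℝ) - 1) * d w * d w' ≤ (d v : ℝ) * (d v : ℝ) * d w * d w' := by
                gcongr; linarith
            _ ≤ (K : ℝ) * K * K * K := by gcongr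
            _ = _ := by ring
        · positivity
    _ = _ := by simp; ring

/-- Loops and coincidences are bounded in expectation at each small vertex, with N ≥ n since all
degrees are at least 1. The sum of squares will be o(n²) on average, so the bound is o(n) for fixed
K. -/
theorem matchAvg_card_lossyVertices_le (hd : ∀ i, 1 ≤ d i) (hn : 16 ≤ n) (K : ℕ) :
    matchAvg d (fun σ => ((lossyVertices d σ K).card : ℝ)) ≤
      (K : ℝ) ^ 2 * (2 + 4 / n * ∑ x, (d x : ℝ) ^ 2) := by
  have hN := le_card_stub hd
  have hN' : (n : ℝ) ≤ Fintype.card (Stub d) := by exact_mod_cast hN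
  have hn' : (0 : ℝ) < n := by exact_mod_cast (by omega : 0 < n)
  have h2 : (2 : ℝ) / Fintype.card (Stub d) ≤ 2 / n := by gcongr
  have h1 : ∀ σ : Equiv.Perm (Stub d), ((lossyVertices d σ K).card : ℝ) ≤
      ∑ v, (if d v ≤ K then 1 else 0) * ((loopCount d σ v : ℝ) + doubleCount d σ v) := by
    intro σ
    have : ((lossyVertices d σ K).card : ℝ) ≤ ((∑ v, if d v ≤ K then
      loopCount d σ v + doubleCount d σ v else 0 : ℕ) : ℝ) := by
      exact_mod_cast card_lossyVertices_le K
    refine this.trans (le_of_eq ?_)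
    push_cast
    exact Finset.sum_congr rfl fun v _ => by rw [ite_mul, one_mul, zero_mul]
  refine (matchAvg_mono fun σ _ => h1 σ).trans ?_
  simp only [matchAvg_sum, matchAvg_const_mul, matchAvg_add]
  have hsq : ∀ v, ((stubPairsAway d v).card : ℝ) ≤ ∑ x, (d x : ℝ) ^ 2 := by
    intro v
    rw [card_stubPairsAway]
    push_cast
    exact Finset.sum_le_sum fun x _ => by
      split_ifs
      · exact le_rfl
      · positivity
  calc _ ≤ ∑ v : Fin n, ((K : ℝ) ^ 2 * (2 / n) +
        (K : ℝ) ^ 2 * (∑ x, (d x : ℝ) ^ 2) * (2 / n) ^ 2) := by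
        refine Finset.sum_le_sum fun v _ => ?_
        split_ifs with hv
        · rw [one_mul]
          have hv' : (d v : ℝ) ≤ K := by exact_mod_cast hv
          refine add_le_add ((matchAvg_loopCount_le v (by omega)).trans ?_)
            ((matchAvg_doubleCount_le v (by omega)).trans ?_)
          · gcongr
          · gcongr
            exact hsq v
        · rw [zero_mul]; positivity
    _ = _ := by
        simp only [Finset.sum_const, Finset.card_univ, Fintype.card_fin, nsmul_eq_mul]
        field_simp
        ring

theorem matchAvg_card_halvedPairs_le (hd : ∀ i, 1 ≤ d i) (hn : 16 ≤ n) {K : ℕ} (hK : 16 ≤ K) :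
    matchAvg d (fun σ => ((halvedPairs d σ K).card : ℝ)) ≤
      ∑ v, (8 / n * (d v : ℝ) ^ 3 + 512 / n ^ 4 * ∑ x, ∑ y, if x ≠ v ∧ y ≠ v then
        (d v : ℝ) ^ 4 * (d x : ℝ) ^ 2 * (d y : ℝ) ^ 2 else 0) := by
  have hN := le_card_stub hd
  have hN' : (n : ℝ) ≤ Fintype.card (Stub d) := by exact_mod_cast hN
  have hn' : (0 : ℝ) < n := by exact_mod_cast (by omega : 0 < n)
  have h2 : (2 : ℝ) / Fintype.card (Stub d) ≤ 2 / n := by gcongr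
  have h1 : ∀ σ : Equiv.Perm (Stub d), ((halvedPairs d σ K).card : ℝ) ≤
      ∑ v, (4 * d v * (loopCount d σ v : ℝ) + 32 * (quadCount d σ v : ℝ)) := by
    intro σ
    have : ((halvedPairs d σ K).card : ℝ) ≤ ((∑ v, (4 * (d v * loopCount d σ v) +
      32 * quadCount d σ v) : ℕ) : ℝ) := by
      exact_mod_cast card_halvedPairs_le hK
    refine this.trans (le_of_eq ?_)
    push_cast
    exact Finset.sum_congr rfl fun v _ => by ring
  refine (matchAvg_mono fun σ _ => h1 σ).trans ?_
  simp only [matchAvg_sum, matchAvg_const_mul, matchAvg_add]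
  refine Finset.sum_le_sum fun v _ => ?_
  -- Keeping x and y different from v leaves the factor d(v)⁴ independent of the other two once the
  -- degrees are random.
  have h3 : ((stubPairsAway d v).card : ℝ) ^ 2 * (d v : ℝ) ^ 4 =
      ∑ x, ∑ y, if x ≠ v ∧ y ≠ v then (d v : ℝ) ^ 4 * (d x : ℝ) ^ 2 * (d y : ℝ) ^ 2 else 0 := by
    rw [card_stubPairsAway, sq]
    push_cast
    rw [Finset.sum_mul_sum, Finset.sum_mul]
    refine Finset.sum_congr rfl fun x _ => ?_
    rw [Finset.sum_mul]
    refine Finset.sum_congr rfl fun y _ => ?_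
    by_cases hx : x = v <;> by_cases hy : y = v <;> simp [hx, hy]
    ring
  rw [← h3]
  refine add_le_add ?_ ?_
  · calc _ ≤ 4 * (d v : ℝ) * ((d v : ℝ) ^ 2 * (2 / n)) := by
          gcongr
          exact (matchAvg_loopCount_le v (by omega)).trans (by gcongr)
      _ = _ := by ring
  · calc _ ≤ 32 * ((d v : ℝ) ^ 4 * ((stubPairsAway d v).card : ℝ) ^ 2 * (2 / n) ^ 4) := by
          gcongr
          exact (matchAvg_quadCount_le v (by omega)).trans (by gcongr)
      _ = _ := by ring

theorem matchAvg_card_stubWedges_le_four (hd : ∀ i, 1 ≤ d i) (hn : 16 ≤ n)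
    (R : ℕ → ℕ → ℕ → Prop) [∀ a b c, Decidable (R a b c)] :
    matchAvg d (fun σ => ((stubWedges d σ R).card : ℝ)) ≤ 4 / n ^ 2 * wedgeWeight d R := by
  have hN := le_card_stub hd
  have hN' : (n : ℝ) ≤ Fintype.card (Stub d) := by exact_mod_cast hN
  have hn' : (16 : ℝ) ≤ n := by exact_mod_cast hn
  refine (matchAvg_stubWedges_le R (by omega)).trans ?_
  rw [mul_comm]
  refine mul_le_mul_of_nonneg_right ?_ (wedgeWeight_nonneg R)
  rw [div_le_div_iff₀ (by apply mul_pos <;> linarith) (by positivity)]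
  nlinarith

/-- The map y ↦ 1/y² has derivative at most 2 in absolute value on [1, ∞). Both N/n and the mean lie
there. -/
theorem abs_inv_sq_sub_le {y μ : ℝ} (hy : 1 ≤ y) (hμ : 1 ≤ μ) :
    |1 / y ^ 2 - 1 / μ ^ 2| ≤ 2 * |y - μ| := by
  have h1 : 1 / y ^ 2 - 1 / μ ^ 2 = (y - μ) * (-((y + μ) / (y ^ 2 * μ ^ 2))) := by
    field_simp
    ring
  rw [h1, abs_mul, mul_comm]
  refine mul_le_mul_of_nonneg_right ?_ (abs_nonneg _)
  rw [abs_neg, abs_of_nonneg (by positivity), div_le_iff₀ (by positivity)]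
  have h2 : 1 ≤ y * μ := by nlinarith
  have h3 : y ≤ y * μ := by nlinarith
  have h4 : μ ≤ y * μ := by nlinarith
  nlinarith

/-- The first error is the gap between the two matching probabilities, the second the replacement of
N by nμ; both use the crude bound n³K⁴ on the weight. -/
theorem abs_matchAvg_capOrdered_sub_le (hd : ∀ i, 1 ≤ d i) (hn : 16 ≤ n) (K : ℕ) {μ : ℝ}
    (hμ : 1 ≤ μ) :
    |matchAvg d (fun σ => ((stubWedges d σ (CapOrdered K)).card : ℝ)) -
        1 / (n ^ 2 * μ ^ 2) * wedgeWeight d (CapOrdered K)| ≤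
      16 * (K : ℝ) ^ 4 + 2 * n * (K : ℝ) ^ 4 * |(∑ i, (d i : ℝ)) / n - μ| := by
  have hN := le_card_stub hd
  have hN' : (n : ℝ) ≤ Fintype.card (Stub d) := by exact_mod_cast hN
  have hn' : (16 : ℝ) ≤ n := by exact_mod_cast hn
  have hsum : (∑ i, (d i : ℝ)) = Fintype.card (Stub d) := by
    rw [card_stub]; push_cast; rfl
  have hlo := le_matchAvg_stubWedges (d := d) (CapOrdered K) (by omega)
  have hhi := matchAvg_stubWedges_le (d := d) (CapOrdered K) (by omega)
  rw [hsum]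
  set N : ℝ := (Fintype.card (Stub d) : ℝ)
  set A := matchAvg d (fun σ => ((stubWedges d σ (CapOrdered K)).card : ℝ))
  have hW0 := wedgeWeight_nonneg (d := d) (CapOrdered K)
  have hW := wedgeWeight_capOrdered_le (d := d) K
  set W := wedgeWeight d (CapOrdered K)
  have h1 : |A - W * (1 / (N * N))| ≤ 16 * (K : ℝ) ^ 4 := by
    rw [abs_of_nonneg (by linarith)]
    have h2 : 1 / ((N - 1) * (N - 3)) - 1 / (N * N) ≤ 16 / n ^ 3 := by
      -- The numerator of the difference is 4N - 3 and (N-1)(N-3) ≥ N²/4, hence 4N · 4/N⁴.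
      have h3 : 1 / ((N - 1) * (N - 3)) - 1 / (N * N) ≤ 16 / N ^ 3 := by
        have hN0 : 0 < N := by linarith
        have hN1 : 0 < N - 1 := by linarith
        have hN3 : 0 < N - 3 := by linarith
        rw [div_sub_div _ _ (by positivity) (by positivity),
          div_le_div_iff₀ (by positivity) (by positivity)]
        have h4 : N ^ 2 ≤ 4 * ((N - 1) * (N - 3)) := by nlinarith
        have h5 : (1 * (N * N) - (N - 1) * (N - 3) * 1) ≤ 4 * N := by nlinarith
        calc _ ≤ 4 * N * N ^ 3 := by gcongr
          _ = 4 * N ^ 2 * (N * N) := by ring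
          _ ≤ 4 * (4 * ((N - 1) * (N - 3))) * (N * N) := by gcongr
          _ = _ := by ring
      exact h3.trans (by gcongr)
    calc A - W * (1 / (N * N)) ≤ W * (1 / ((N - 1) * (N - 3)) - 1 / (N * N)) := by linarith
      _ ≤ W * (16 / n ^ 3) := by gcongr
      _ ≤ ((n : ℝ) ^ 3 * (K : ℝ) ^ 4) * (16 / n ^ 3) := by gcongr
      _ = _ := by field_simp
  have h2 : |W * (1 / (N * N)) - 1 / (n ^ 2 * μ ^ 2) * W| ≤
      2 * n * (K : ℝ) ^ 4 * |N / n - μ| := by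
    have h3 : W * (1 / (N * N)) - 1 / (n ^ 2 * μ ^ 2) * W =
        W * (1 / n ^ 2) * (1 / (N / n) ^ 2 - 1 / μ ^ 2) := by
      field_simp
    rw [h3, abs_mul, abs_of_nonneg (by positivity)]
    have h4 : 1 ≤ N / n := by rw [le_div_iff₀ (by linarith)]; linarith
    calc _ ≤ ((n : ℝ) ^ 3 * (K : ℝ) ^ 4) * (1 / n ^ 2) * (2 * |N / n - μ|) := by
          gcongr
          exact abs_inv_sq_sub_le h4 hμ
      _ = _ := by field_simp
  calc _ ≤ |A - W * (1 / (N * N))| + |W * (1 / (N * N)) - 1 / (n ^ 2 * μ ^ 2) * W| :=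
        abs_sub_le _ _ _
    _ ≤ _ := add_le_add h1 h2

/-- Tail wedges and halved pairs enter only the upper half of the sandwich; being nonnegative they
may be added to both sides of the error. -/
theorem abs_matchAvg_bucketWedges_sub_le (hd : ∀ i, 1 ≤ d i) (hn : 16 ≤ n) {K : ℕ} (hK : 16 ≤ K)
    {μ : ℝ} (hμ : 1 ≤ μ) :
    |matchAvg d (fun σ => ((bucketWedges d σ).card : ℝ)) -
        1 / (n ^ 2 * μ ^ 2) * wedgeWeight d (CapOrdered K)| ≤
      16 * (K : ℝ) ^ 4 + 2 * n * (K : ℝ) ^ 4 * |(∑ i, (d i : ℝ)) / n - μ| +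
      4 / n ^ 2 * wedgeWeight d (TailOrdered K) +
      3 * (K : ℝ) ^ 2 * ((K : ℝ) ^ 2 * (2 + 4 / n * ∑ x, (d x : ℝ) ^ 2)) +
      ∑ v, (8 / n * (d v : ℝ) ^ 3 + 512 / n ^ 4 * ∑ x, ∑ y, if x ≠ v ∧ y ≠ v then
        (d v : ℝ) ^ 4 * (d x : ℝ) ^ 2 * (d y : ℝ) ^ 2 else 0) := by
  have h1 := abs_matchAvg_capOrdered_sub_le hd hn K hμ
  have h2 := matchAvg_card_stubWedges_le_four hd hn (TailOrdered K)
  have h3 := matchAvg_card_lossyVertices_le hd hn K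
  have h4 := matchAvg_card_halvedPairs_le hd hn hK
  have h5 : matchAvg d (fun σ => ((bucketWedges d σ).card : ℝ)) ≤
      matchAvg d (fun σ => ((stubWedges d σ (CapOrdered K)).card : ℝ)) +
      matchAvg d (fun σ => ((stubWedges d σ (TailOrdered K)).card : ℝ)) +
      3 * (K : ℝ) ^ 2 * matchAvg d (fun σ => ((lossyVertices d σ K).card : ℝ)) +
      matchAvg d (fun σ => ((halvedPairs d σ K).card : ℝ)) := by
    rw [← matchAvg_const_mul, ← matchAvg_add, ← matchAvg_add, ← matchAvg_add]
    refine matchAvg_mono fun σ _ => ?_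
    exact_mod_cast card_bucketWedges_le K
  have h6 : matchAvg d (fun σ => ((stubWedges d σ (CapOrdered K)).card : ℝ)) ≤
      matchAvg d (fun σ => ((bucketWedges d σ).card : ℝ)) +
      3 * (K : ℝ) ^ 2 * matchAvg d (fun σ => ((lossyVertices d σ K).card : ℝ)) := by
    rw [← matchAvg_const_mul, ← matchAvg_add]
    refine matchAvg_mono fun σ _ => ?_
    exact_mod_cast card_stubWedges_le K
  have h7 : 0 ≤ matchAvg d (fun σ => ((stubWedges d σ (TailOrdered K)).card : ℝ)) :=
    matchAvg_nonneg fun σ _ => Nat.cast_nonneg _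
  have h8 : 0 ≤ matchAvg d (fun σ => ((halvedPairs d σ K).card : ℝ)) :=
    matchAvg_nonneg fun σ _ => Nat.cast_nonneg _
  have h9 : 3 * (K : ℝ) ^ 2 * matchAvg d (fun σ => ((lossyVertices d σ K).card : ℝ)) ≤
      3 * (K : ℝ) ^ 2 * ((K : ℝ) ^ 2 * (2 + 4 / n * ∑ x, (d x : ℝ) ^ 2)) :=
    mul_le_mul_of_nonneg_left h3 (by positivity)
  rw [abs_le] at h1 ⊢
  constructor <;> linarith [h1.1, h1.2]

end FixedDegrees

/-! ### Error bounds for random degrees -/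

section RandomDegrees

variable {S : Finset ℕ} {p : ℕ → ℝ} {n : ℕ}

/-- For x ≠ y the three degrees are independent and give M₄M₂²; on the diagonal x = y the two
squares merge into a fourth power and give M₄², over only n² choices. -/
theorem prodExp_quartic_le (hp : ∀ t ∈ S, 0 ≤ p t) (h1 : ∑ t ∈ S, p t = 1) :
    prodExp S p (fun d : Fin n → ℕ => ∑ v, ∑ x, ∑ y, if x ≠ v ∧ y ≠ v then
        (d v : ℝ) ^ 4 * (d x : ℝ) ^ 2 * (d y : ℝ) ^ 2 else 0) ≤
      (n : ℝ) ^ 3 * ((∑ t ∈ S, p t * (t : ℝ) ^ 4) * (∑ t ∈ S, p t * (t : ℝ) ^ 2) ^ 2) +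
      (n : ℝ) ^ 2 * (∑ t ∈ S, p t * (t : ℝ) ^ 4) ^ 2 := by
  set M2 := ∑ t ∈ S, p t * (t : ℝ) ^ 2 with hM2
  set M4 := ∑ t ∈ S, p t * (t : ℝ) ^ 4 with hM4
  have h2 : 0 ≤ M2 := Finset.sum_nonneg fun t ht => mul_nonneg (hp t ht) (by positivity)
  have h4 : 0 ≤ M4 := Finset.sum_nonneg fun t ht => mul_nonneg (hp t ht) (by positivity)
  simp only [prodExp_sum]
  calc _ ≤ ∑ v : Fin n, ∑ x : Fin n, ∑ y : Fin n,
        (M4 * M2 ^ 2 + if y = x then M4 ^ 2 else 0) := by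
        refine Finset.sum_le_sum fun v _ => Finset.sum_le_sum fun x _ =>
          Finset.sum_le_sum fun y _ => ?_
        by_cases hxy : x ≠ v ∧ y ≠ v
        · simp only [hxy, ne_eq, not_false_eq_true, and_self, if_true]
          by_cases hyx : y = x
          · subst hyx
            rw [if_pos rfl, prodExp_pair h1 hxy.1
              (fun a b => (a : ℝ) ^ 4 * (b : ℝ) ^ 2 * (b : ℝ) ^ 2)]
            have h3 : ∑ a ∈ S, ∑ b ∈ S, p a * p b * ((a : ℝ) ^ 4 * (b : ℝ) ^ 2 * (b : ℝ) ^ 2) =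
                M4 ^ 2 := by
              rw [sq, hM4, Finset.sum_mul_sum]
              exact Finset.sum_congr rfl fun a _ => Finset.sum_congr rfl fun b _ => by ring
            rw [h3]
            have : 0 ≤ M4 * M2 ^ 2 := by positivity
            linarith
          · rw [if_neg hyx, prodExp_triple h1 hxy.1 hxy.2 (Ne.symm hyx)
              (fun a b c => (a : ℝ) ^ 4 * (b : ℝ) ^ 2 * (c : ℝ) ^ 2), add_zero]
            refine le_of_eq ?_
            rw [sq M2, hM4, hM2, Finset.sum_mul_sum, Finset.sum_mul_sum]
            refine Finset.sum_congr rfl fun a _ => Finset.sum_congr rfl fun b _ => ?_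
            rw [Finset.mul_sum]
            exact Finset.sum_congr rfl fun c _ => by ring
        · simp only [hxy, if_false]
          rw [prodExp_const h1]
          split_ifs <;> positivity
    _ = _ := by
        simp [Finset.sum_add_distrib]
        ring

theorem abs_prodExp_bucketWedges_sub_le (hS : ∀ t ∈ S, 1 ≤ t) (hp : ∀ t ∈ S, 0 ≤ p t)
    (h1 : ∑ t ∈ S, p t = 1) (hn : 16 ≤ n) {K : ℕ} (hK : 16 ≤ K) {μ : ℝ} (hμ : 1 ≤ μ)
    {δ : ℝ} (hδ : 0 < δ) :
    |1 / (n : ℝ) * prodExp S p (fun d : Fin n → ℕ =>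
          matchAvg d (fun σ => ((bucketWedges d σ).card : ℝ))) -
        ((n : ℝ) - 1) * ((n : ℝ) - 2) / n ^ 2 * (1 / μ ^ 2) *
          ∑ a ∈ S, ∑ b ∈ S, ∑ c ∈ S, p a * p b * p c *
            if CapOrdered K a b c then (a : ℝ) * ((a : ℝ) - 1) * b * c else 0| ≤
      16 * (K : ℝ) ^ 4 * (1 / n) + 2 * (K : ℝ) ^ 4 *
        (|∑ t ∈ S, p t * t - μ| + δ + (∑ t ∈ S, p t * (t : ℝ) ^ 2) / (n * δ)) +
      4 * (∑ a ∈ S, ∑ b ∈ S, ∑ c ∈ S, p a * p b * p c *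
            if TailOrdered K a b c then (a : ℝ) * ((a : ℝ) - 1) * b * c else 0) +
      3 * (K : ℝ) ^ 4 * (2 * (1 / n) + 4 * ((∑ t ∈ S, p t * (t : ℝ) ^ 2) / n)) +
      (8 * ((∑ t ∈ S, p t * (t : ℝ) ^ 3) / n) + 512 *
        ((∑ t ∈ S, p t * (t : ℝ) ^ 4) * (∑ t ∈ S, p t * (t : ℝ) ^ 2) ^ 2 / n ^ 2 +
          (∑ t ∈ S, p t * (t : ℝ) ^ 4) ^ 2 / n ^ 3)) := by
  have hn' : (16 : ℝ) ≤ n := by exact_mod_cast hn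
  have hn0 : (0 : ℝ) < n := by linarith
  have hbd : ∀ d : Fin n → ℕ, (∀ i, d i ∈ S) → _ := fun d hd =>
    abs_matchAvg_bucketWedges_sub_le (K := K) (fun i => hS _ (hd i)) hn hK hμ
  have hup := prodExp_mono hp (n := n) fun d hd => (abs_le.1 (hbd d hd)).2
  have hlo := prodExp_mono hp (n := n) fun d hd =>
    neg_le.1 ((abs_le.1 (hbd d hd)).1)
  have hneg : ∀ d : Fin n → ℕ, -(matchAvg d (fun σ => ((bucketWedges d σ).card : ℝ)) -
        1 / (n ^ 2 * μ ^ 2) * wedgeWeight d (CapOrdered K)) =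
        (-1) * (matchAvg d (fun σ => ((bucketWedges d σ).card : ℝ)) -
        1 / (n ^ 2 * μ ^ 2) * wedgeWeight d (CapOrdered K)) := fun d => by ring
  have hM : prodExp S p (fun d : Fin n → ℕ => 16 * (K : ℝ) ^ 4 +
      2 * n * (K : ℝ) ^ 4 * |(∑ i, (d i : ℝ)) / n - μ| +
      4 / n ^ 2 * wedgeWeight d (TailOrdered K) +
      3 * (K : ℝ) ^ 2 * ((K : ℝ) ^ 2 * (2 + 4 / n * ∑ x, (d x : ℝ) ^ 2)) +
      ∑ v, (8 / n * (d v : ℝ) ^ 3 + 512 / n ^ 4 * ∑ x, ∑ y, if x ≠ v ∧ y ≠ v then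
        (d v : ℝ) ^ 4 * (d x : ℝ) ^ 2 * (d y : ℝ) ^ 2 else 0)) ≤
      n * (16 * (K : ℝ) ^ 4 * (1 / n) + 2 * (K : ℝ) ^ 4 *
        (|∑ t ∈ S, p t * t - μ| + δ + (∑ t ∈ S, p t * (t : ℝ) ^ 2) / (n * δ)) +
      4 * (∑ a ∈ S, ∑ b ∈ S, ∑ c ∈ S, p a * p b * p c *
            if TailOrdered K a b c then (a : ℝ) * ((a : ℝ) - 1) * b * c else 0) +
      3 * (K : ℝ) ^ 4 * (2 * (1 / n) + 4 * ((∑ t ∈ S, p t * (t : ℝ) ^ 2) / n)) +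
      (8 * ((∑ t ∈ S, p t * (t : ℝ) ^ 3) / n) + 512 *
        ((∑ t ∈ S, p t * (t : ℝ) ^ 4) * (∑ t ∈ S, p t * (t : ℝ) ^ 2) ^ 2 / n ^ 2 +
          (∑ t ∈ S, p t * (t : ℝ) ^ 4) ^ 2 / n ^ 3))) := by
    have e1 := prodExp_abs_mean_sub_le (n := n) hp h1 (by omega) μ hδ
    have e2 := prodExp_quartic_le (n := n) hp h1
    have e3 : ∀ v : Fin n, prodExp S p (fun d : Fin n → ℕ => (d v : ℝ) ^ 2) =
      ∑ t ∈ S, p t * (t : ℝ) ^ 2 := fun v => prodExp_single h1 v (fun t => (t : ℝ) ^ 2)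
    have e4 : ∀ v : Fin n, prodExp S p (fun d : Fin n → ℕ => (d v : ℝ) ^ 3) =
      ∑ t ∈ S, p t * (t : ℝ) ^ 3 := fun v => prodExp_single h1 v (fun t => (t : ℝ) ^ 3)
    have e5 := prodExp_wedgeWeight (n := n) h1 (TailOrdered K)
    simp only [Finset.sum_add_distrib, ← Finset.mul_sum]
    rw [prodExp_add, prodExp_add, prodExp_add, prodExp_add, prodExp_const h1, prodExp_const_mul,
      prodExp_const_mul, prodExp_const_mul, prodExp_const_mul, prodExp_add, prodExp_const h1,
      prodExp_const_mul, prodExp_add, prodExp_const_mul, prodExp_const_mul, prodExp_sum,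
      prodExp_sum, e5]
    simp only [e3, e4, Finset.sum_const, Finset.card_univ, Fintype.card_fin, nsmul_eq_mul]
    generalize prodExp S p (fun d : Fin n → ℕ => |(∑ i, (d i : ℝ)) / n - μ|) = A at e1 ⊢
    generalize prodExp S p (fun d : Fin n → ℕ => ∑ v, ∑ x, ∑ y, if x ≠ v ∧ y ≠ v then
        (d v : ℝ) ^ 4 * (d x : ℝ) ^ 2 * (d y : ℝ) ^ 2 else 0) = B at e2 ⊢
    have hT : 0 ≤ ∑ a ∈ S, ∑ b ∈ S, ∑ c ∈ S, p a * p b * p c *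
            if TailOrdered K a b c then (a : ℝ) * ((a : ℝ) - 1) * b * c else 0 := by
      refine Finset.sum_nonneg fun a ha => Finset.sum_nonneg fun b hb =>
        Finset.sum_nonneg fun c hc => mul_nonneg
          (mul_nonneg (mul_nonneg (hp a ha) (hp b hb)) (hp c hc)) ?_
      have : (0 : ℝ) ≤ (a : ℝ) - 1 := by
        rw [sub_nonneg]; exact_mod_cast hS a ha
      split_ifs <;> positivity
    generalize (∑ a ∈ S, ∑ b ∈ S, ∑ c ∈ S, p a * p b * p c *
            if TailOrdered K a b c then (a : ℝ) * ((a : ℝ) - 1) * b * c else 0) = T at hT ⊢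
    generalize (∑ t ∈ S, p t * (t : ℝ) ^ 2) = M2 at e1 e2 ⊢
    generalize (∑ t ∈ S, p t * (t : ℝ) ^ 3) = M3
    generalize (∑ t ∈ S, p t * (t : ℝ) ^ 4) = M4 at e2 ⊢
    have f1 : 2 * n * (K : ℝ) ^ 4 * A ≤ 2 * n * (K : ℝ) ^ 4 *
        (|∑ t ∈ S, p t * t - μ| + δ + M2 / (n * δ)) := by gcongr
    have f2 : 512 / (n : ℝ) ^ 4 * B ≤ 512 / (n : ℝ) ^ 4 *
        ((n : ℝ) ^ 3 * (M4 * M2 ^ 2) + (n : ℝ) ^ 2 * M4 ^ 2) := by gcongr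
    have f3 : 4 / (n : ℝ) ^ 2 * ((n : ℝ) * ((n : ℝ) - 1) * ((n : ℝ) - 2) * T) ≤
        4 / (n : ℝ) ^ 2 * ((n : ℝ) ^ 3 * T) := by
      gcongr
      nlinarith
    have g2 : 512 / (n : ℝ) ^ 4 * ((n : ℝ) ^ 3 * (M4 * M2 ^ 2) + (n : ℝ) ^ 2 * M4 ^ 2) =
        n * (512 * (M4 * M2 ^ 2 / n ^ 2 + M4 ^ 2 / n ^ 3)) := by
      field_simp
    have g3 : 4 / (n : ℝ) ^ 2 * ((n : ℝ) ^ 3 * T) = n * (4 * T) := by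
      field_simp
    have g4 : 16 * (K : ℝ) ^ 4 = n * (16 * (K : ℝ) ^ 4 * (1 / n)) := by field_simp
    have g5 : 3 * (K : ℝ) ^ 2 * ((K : ℝ) ^ 2 * (2 + 4 / n * (n * M2))) =
        n * (3 * (K : ℝ) ^ 4 * (2 * (1 / n) + 4 * (M2 / n))) := by
      field_simp
    have g6 : 8 / (n : ℝ) * (n * M3) = n * (8 * (M3 / n)) := by
      field_simp
    rw [g2] at f2
    rw [g3] at f3
    rw [g5, g6]
    linarith
  simp only [hneg] at hlo
  have hlo' := hlo.trans hM
  have hup' := hup.trans hM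
  rw [prodExp_const_mul] at hlo'
  rw [prodExp_sub, prodExp_const_mul, prodExp_wedgeWeight h1] at hlo' hup'
  generalize (∑ a ∈ S, ∑ b ∈ S, ∑ c ∈ S, p a * p b * p c *
            if CapOrdered K a b c then (a : ℝ) * ((a : ℝ) - 1) * b * c else 0) = ω at hlo' hup' ⊢
  generalize prodExp S p (fun d : Fin n → ℕ =>
          matchAvg d (fun σ => ((bucketWedges d σ).card : ℝ))) = w at hlo' hup' ⊢
  have hw : 1 / (n : ℝ) * w - ((n : ℝ) - 1) * ((n : ℝ) - 2) / n ^ 2 * (1 / μ ^ 2) * ω =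
      1 / n * (w - 1 / (n ^ 2 * μ ^ 2) * (n * (n - 1) * (n - 2) * ω)) := by
    field_simp
  rw [hw, abs_mul, abs_of_pos (by positivity : (0 : ℝ) < 1 / n), 
    one_div_mul_eq_div (n : ℝ) |_|, div_le_iff₀' hn0, abs_le]
  constructor <;> linarith

end RandomDegrees

/-! ### The inequality behind the exponent 4/3 -/

section Cube

theorem rpow_third_pow (t : ℕ) : ((t : ℝ) ^ (1 / 3 : ℝ)) ^ 3 = t := by
  rw [← Real.rpow_natCast, ← Real.rpow_mul (Nat.cast_nonneg t)]
  norm_num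

theorem rpow_third_pow_four (t : ℕ) : ((t : ℝ) ^ (1 / 3 : ℝ)) ^ 4 = (t : ℝ) ^ (4 / 3 : ℝ) := by
  rw [← Real.rpow_natCast, ← Real.rpow_mul (Nat.cast_nonneg t)]
  norm_num

/-- Since x⁶ ≤ 4y³z³ ≤ (2yz)³, two of the six factors x can be traded for 2yz, which balances all
exponents at 4. The degrees are the cubes, so 4 becomes 4/3. -/
theorem cube_mul_cube_le {x y z : ℝ} (hx : 0 ≤ x) (hy : 0 ≤ y) (hz : 0 ≤ z)
    (hxy : x ^ 3 ≤ 2 * y ^ 3) (hxz : x ^ 3 ≤ 2 * z ^ 3) :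
    x ^ 3 * x ^ 3 * y ^ 3 * z ^ 3 ≤ 2 * (x ^ 4 * y ^ 4 * z ^ 4) := by
  have h1 : x ^ 2 ≤ 2 * (y * z) := by
    rw [← pow_le_pow_iff_left₀ (by positivity) (by positivity) (three_ne_zero)]
    calc (x ^ 2) ^ 3 = x ^ 3 * x ^ 3 := by ring
      _ ≤ (2 * y ^ 3) * (2 * z ^ 3) := by gcongr
      _ ≤ (2 * (y * z)) ^ 3 := by
        have : 0 ≤ (y * z) ^ 3 := by positivity
        nlinarith
  calc x ^ 3 * x ^ 3 * y ^ 3 * z ^ 3 = x ^ 2 * (x ^ 4 * y ^ 3 * z ^ 3) := by ring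
    _ ≤ (2 * (y * z)) * (x ^ 4 * y ^ 3 * z ^ 3) := by gcongr
    _ = _ := by ring

theorem wedge_weight_le {a b c : ℕ} (hab : a ≤ 2 * b) (hac : a ≤ 2 * c) :
    (a : ℝ) * ((a : ℝ) - 1) * b * c ≤
      2 * ((a : ℝ) ^ (4 / 3 : ℝ) * (b : ℝ) ^ (4 / 3 : ℝ) * (c : ℝ) ^ (4 / 3 : ℝ)) := by
  have hab' : (a : ℝ) ≤ 2 * b := by exact_mod_cast hab
  have hac' : (a : ℝ) ≤ 2 * c := by exact_mod_cast hac
  have h1 : (a : ℝ) * ((a : ℝ) - 1) * b * c ≤ (a : ℝ) * a * b * c := by gcongr; linarith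
  refine h1.trans ?_
  have h := cube_mul_cube_le (x := (a : ℝ) ^ (1 / 3 : ℝ)) (y := (b : ℝ) ^ (1 / 3 : ℝ))
    (z := (c : ℝ) ^ (1 / 3 : ℝ)) (by positivity) (by positivity) (by positivity)
  simp only [rpow_third_pow, rpow_third_pow_four] at h
  exact h hab' hac'

end Cube

/-! ### Moments of a law supported below the cap -/

section Moments

variable {S : Finset ℕ} {p : ℕ → ℝ} {M : ℕ}

theorem sum_mul_le_of_le (hp : ∀ t ∈ S, 0 ≤ p t) {g h : ℕ → ℝ} {c : ℝ}
    (hgh : ∀ t ∈ S, g t ≤ c * h t) : ∑ t ∈ S, p t * g t ≤ c * ∑ t ∈ S, p t * h t := by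
  rw [Finset.mul_sum]
  refine Finset.sum_le_sum fun t ht => ?_
  calc p t * g t ≤ p t * (c * h t) := mul_le_mul_of_nonneg_left (hgh t ht) (hp t ht)
    _ = _ := by ring

theorem sum_mul_pow_succ_le (hp : ∀ t ∈ S, 0 ≤ p t) (hM : ∀ t ∈ S, t ≤ M) (k : ℕ) :
    ∑ t ∈ S, p t * (t : ℝ) ^ (k + 1) ≤ (M : ℝ) ^ k * ∑ t ∈ S, p t * (t : ℝ) := by
  refine sum_mul_le_of_le hp fun t ht => ?_
  have : (t : ℝ) ≤ M := by exact_mod_cast hM t ht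
  rw [pow_succ]
  gcongr

/-- Pointwise t⁴ ≤ M^(8/3) t^(4/3) and t² ≤ M^(2/3) t^(4/3), and 8/3 + 2 · 2/3 = 4. Against n² this
leaves (M²/n)², which tends to 0 for the actual cap. -/
theorem fourth_mul_sq_second_le (hp : ∀ t ∈ S, 0 ≤ p t) (hM : ∀ t ∈ S, t ≤ M) :
    (∑ t ∈ S, p t * (t : ℝ) ^ 4) * (∑ t ∈ S, p t * (t : ℝ) ^ 2) ^ 2 ≤
      (M : ℝ) ^ 4 * (∑ t ∈ S, p t * (t : ℝ) ^ (4 / 3 : ℝ)) ^ 3 := by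
  set r : ℕ → ℝ := fun t => (t : ℝ) ^ (1 / 3 : ℝ) with hr
  have hr0 : ∀ t, 0 ≤ r t := fun t => by positivity
  have hr3 : ∀ t : ℕ, (t : ℝ) = r t ^ 3 := fun t => (rpow_third_pow t).symm
  have hr4 : ∀ t : ℕ, (t : ℝ) ^ (4 / 3 : ℝ) = r t ^ 4 := fun t => (rpow_third_pow_four t).symm
  have hrM : ∀ t ∈ S, r t ≤ r M := fun t ht =>
    Real.rpow_le_rpow (Nat.cast_nonneg t) (by exact_mod_cast hM t ht) (by norm_num)
  set Q := ∑ t ∈ S, p t * (t : ℝ) ^ (4 / 3 : ℝ)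
  have hQ : 0 ≤ Q := Finset.sum_nonneg fun t ht => mul_nonneg (hp t ht) (by positivity)
  have h4 : ∑ t ∈ S, p t * (t : ℝ) ^ 4 ≤ r M ^ 8 * Q := by
    refine sum_mul_le_of_le hp fun t ht => ?_
    rw [hr4, hr3 t]
    calc (r t ^ 3) ^ 4 = r t ^ 8 * r t ^ 4 := by ring
      _ ≤ _ := by have := hrM t ht; have := hr0 t; gcongr
  have h2 : ∑ t ∈ S, p t * (t : ℝ) ^ 2 ≤ r M ^ 2 * Q := by
    refine sum_mul_le_of_le hp fun t ht => ?_
    rw [hr4, hr3 t]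
    calc (r t ^ 3) ^ 2 = r t ^ 2 * r t ^ 4 := by ring
      _ ≤ _ := by have := hrM t ht; have := hr0 t; gcongr
  have h20 : 0 ≤ ∑ t ∈ S, p t * (t : ℝ) ^ 2 :=
    Finset.sum_nonneg fun t ht => mul_nonneg (hp t ht) (by positivity)
  have := hr0 M
  calc _ ≤ (r M ^ 8 * Q) * (r M ^ 2 * Q) ^ 2 := by gcongr
    _ = (r M ^ 3) ^ 4 * Q ^ 3 := by ring
    _ = _ := by rw [← hr3]

/-- A union bound over which of the three degrees exceeds K gives the factor 3; the other 2 comes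
from `wedge_weight_le`. -/
theorem tail_sum_le (hp : ∀ t ∈ S, 0 ≤ p t) (K : ℕ) :
    (∑ a ∈ S, ∑ b ∈ S, ∑ c ∈ S, p a * p b * p c *
        if TailOrdered K a b c then (a : ℝ) * ((a : ℝ) - 1) * b * c else 0) ≤
      6 * (∑ t ∈ S, p t * (t : ℝ) ^ (4 / 3 : ℝ)) ^ 2 *
        ∑ t ∈ S, p t * (if K < t then (t : ℝ) ^ (4 / 3 : ℝ) else 0) := by
  set q : ℕ → ℝ := fun t => p t * (t : ℝ) ^ (4 / 3 : ℝ) with hq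
  set e : ℕ → ℝ := fun t => p t * (if K < t then (t : ℝ) ^ (4 / 3 : ℝ) else 0) with he
  have hq0 : ∀ t ∈ S, 0 ≤ q t := fun t ht => mul_nonneg (hp t ht) (by positivity)
  have he0 : ∀ t ∈ S, 0 ≤ e t := fun t ht => mul_nonneg (hp t ht) (by split_ifs <;> positivity)
  have heq : ∀ t, K < t → e t = q t := fun t ht => by simp [he, hq, ht]
  have h3 : ∀ x y z : ℕ → ℝ, ∑ a ∈ S, ∑ b ∈ S, ∑ c ∈ S, x a * y b * z c =
      (∑ t ∈ S, x t) * (∑ t ∈ S, y t) * ∑ t ∈ S, z t := by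
    intro x y z
    rw [Finset.sum_mul_sum, Finset.sum_mul]
    refine Finset.sum_congr rfl fun a _ => ?_
    rw [Finset.sum_mul]
    exact Finset.sum_congr rfl fun b _ => by rw [Finset.mul_sum]
  calc _ ≤ ∑ a ∈ S, ∑ b ∈ S, ∑ c ∈ S,
        2 * (e a * q b * q c + q a * e b * q c + q a * q b * e c) := by
        refine Finset.sum_le_sum fun a ha => Finset.sum_le_sum fun b hb =>
          Finset.sum_le_sum fun c hc => ?_
        have ha0 := hq0 a ha
        have hb0 := hq0 b hb
        have hc0 := hq0 c hc
        have ha1 := he0 a ha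
        have hb1 := he0 b hb
        have hc1 := he0 c hc
        split_ifs with h
        · have h1 : p a * p b * p c * ((a : ℝ) * ((a : ℝ) - 1) * b * c) ≤ 2 * (q a * q b * q c) := by
            calc _ ≤ p a * p b * p c * (2 * ((a : ℝ) ^ (4 / 3 : ℝ) * (b : ℝ) ^ (4 / 3 : ℝ) *
                  (c : ℝ) ^ (4 / 3 : ℝ))) :=
                  mul_le_mul_of_nonneg_left (wedge_weight_le h.1 h.2.1)
                    (mul_nonneg (mul_nonneg (hp a ha) (hp b hb)) (hp c hc))
              _ = _ := by simp only [hq]; ring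
          have p1 : 0 ≤ e a * q b * q c := by positivity
          have p2 : 0 ≤ q a * e b * q c := by positivity
          have p3 : 0 ≤ q a * q b * e c := by positivity
          rcases h.2.2 with h2 | h2 | h2
          · rw [heq a h2] at p1 ⊢; linarith
          · rw [heq b h2] at p2 ⊢; linarith
          · rw [heq c h2] at p3 ⊢; linarith
        · rw [mul_zero]; positivity
    _ = 2 * ((∑ t ∈ S, e t) * (∑ t ∈ S, q t) * (∑ t ∈ S, q t) +
          (∑ t ∈ S, q t) * (∑ t ∈ S, e t) * (∑ t ∈ S, q t) +
          (∑ t ∈ S, q t) * (∑ t ∈ S, q t) * (∑ t ∈ S, e t)) := by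
        rw [← h3, ← h3, ← h3]
        simp only [← Finset.sum_add_distrib, Finset.mul_sum]
    _ = _ := by ring

end Moments

/-! ### Growth of the degree cap -/

section DegreeCap

theorem degreeCap_le (n : ℕ) : (degreeCap n : ℝ) ≤ Real.sqrt n / Real.log n ^ 2 :=
  Nat.floor_le (by positivity)

theorem tendsto_degreeCap : Tendsto degreeCap atTop atTop := by
  refine tendsto_nat_floor_atTop.comp ?_
  have h1 : Tendsto (fun x : ℝ => Real.log x ^ 2 / Real.sqrt x) atTop (𝓝 0) := by
    have h := (isLittleO_log_rpow_rpow_atTop 2 (by norm_num : (0 : ℝ) < 1 / 2)).tendsto_div_nhds_zero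
    refine h.congr fun x => ?_
    rw [Real.sqrt_eq_rpow, Real.rpow_two]
  have h2 : Tendsto (fun x : ℝ => Real.log x ^ 2 / Real.sqrt x) atTop (𝓝[>] 0) := by
    rw [tendsto_nhdsWithin_iff]
    refine ⟨h1, ?_⟩
    filter_upwards [eventually_gt_atTop 1] with x hx
    have := Real.log_pos hx
    have : 0 < Real.sqrt x := Real.sqrt_pos.2 (by linarith)
    exact Set.mem_Ioi.2 (by positivity)
  have h3 := (tendsto_inv_nhdsGT_zero.comp h2).comp tendsto_natCast_atTop_atTop
  refine h3.congr fun n => ?_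
  simp

/-- The quotient is at most 1/log⁴ n. This and divergence of the cap are the only properties of the
cap used in the limit. -/
theorem tendsto_degreeCap_sq_div :
    Tendsto (fun n : ℕ => (degreeCap n : ℝ) ^ 2 / n) atTop (𝓝 0) := by
  have h1 : Tendsto (fun n : ℕ => (Real.log (n : ℝ) ^ 4)⁻¹) atTop (𝓝 0) :=
    tendsto_inv_atTop_zero.comp ((tendsto_pow_atTop (by norm_num)).comp
      (Real.tendsto_log_atTop.comp tendsto_natCast_atTop_atTop))
  refine squeeze_zero' (Eventually.of_forall fun n => by positivity) ?_ h1
  filter_upwards [eventually_ge_atTop 2] with n hn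
  have hn' : (2 : ℝ) ≤ n := by exact_mod_cast hn
  have hlog : 0 < Real.log n := Real.log_pos (by linarith)
  calc (degreeCap n : ℝ) ^ 2 / n ≤ (Real.sqrt n / Real.log n ^ 2) ^ 2 / n := by
        gcongr
        exact degreeCap_le n
    _ = _ := by
        rw [div_pow, Real.sq_sqrt (by linarith)]
        field_simp

theorem tendsto_sum_Icc_degreeCap {g : ℕ → ℝ} (h0 : g 0 = 0) (hg : Summable g) :
    Tendsto (fun n => ∑ t ∈ Finset.Icc 1 (degreeCap n), g t) atTop (𝓝 (∑' t, g t)) := by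
  have h1 := (hg.hasSum.tendsto_sum_nat.comp (tendsto_add_atTop_nat 1)).comp tendsto_degreeCap
  refine h1.congr fun n => ?_
  simp only [Function.comp]
  rw [Finset.range_eq_Ico, Finset.sum_eq_sum_Ico_succ_bot (Nat.succ_pos _), h0, zero_add]
  rfl

end DegreeCap

/-! ### Passing to the limit, first in n and then in K -/

section Limit

variable {f : ℕ → ℝ}

theorem truncatedProb_nonneg (hf : ∀ t, 0 ≤ f t) (n t : ℕ) : 0 ≤ truncatedProb f n t := by
  rw [truncatedProb]
  split_ifs
  · exact div_nonneg (hf t) (Finset.sum_nonneg fun s _ => hf s)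
  · exact le_rfl

theorem tendsto_sum_Icc_one (hf_sum : HasSum f 1) (hf_zero : f 0 = 0) :
    Tendsto (fun n => ∑ t ∈ Finset.Icc 1 (degreeCap n), f t) atTop (𝓝 1) := by
  have := tendsto_sum_Icc_degreeCap hf_zero hf_sum.summable
  rwa [hf_sum.tsum_eq] at this

theorem eventually_sum_truncatedProb (hf_sum : HasSum f 1) (hf_zero : f 0 = 0) :
    ∀ᶠ n in atTop, ∑ t ∈ Finset.Icc 1 (degreeCap n), truncatedProb f n t = 1 := by
  filter_upwards [(tendsto_sum_Icc_one hf_sum hf_zero).eventually_ne one_ne_zero] with n hn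
  rw [← div_self hn, Finset.sum_div]
  exact Finset.sum_congr rfl fun t ht => by rw [truncatedProb, if_pos ht]

theorem tendsto_sum_truncatedProb_mul (hf_sum : HasSum f 1) (hf_zero : f 0 = 0) {h : ℕ → ℝ}
    (hs : Summable fun t => h t * f t) :
    Tendsto (fun n => ∑ t ∈ Finset.Icc 1 (degreeCap n), truncatedProb f n t * h t) atTop
      (𝓝 (∑' t, h t * f t)) := by
  have h1 := (tendsto_sum_Icc_degreeCap (by simp [hf_zero]) hs).div
    (tendsto_sum_Icc_one hf_sum hf_zero) one_ne_zero
  rw [div_one] at h1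
  refine h1.congr fun n => ?_
  simp only [Pi.div_apply]
  rw [Finset.sum_div]
  refine Finset.sum_congr rfl fun t ht => ?_
  rw [truncatedProb, if_pos ht]
  ring

theorem tendsto_truncatedProb (hf_sum : HasSum f 1) (hf_zero : f 0 = 0) (t : ℕ) :
    Tendsto (fun n => truncatedProb f n t) atTop (𝓝 (f t)) := by
  rcases Nat.eq_zero_or_pos t with rfl | ht
  · rw [hf_zero]
    exact tendsto_const_nhds.congr fun n => by simp [truncatedProb]
  · have h1 := (tendsto_const_nhds (x := f t)).div (tendsto_sum_Icc_one hf_sum hf_zero) one_ne_zero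
    rw [div_one] at h1
    refine h1.congr' ?_
    filter_upwards [tendsto_degreeCap.eventually_ge_atTop t] with n hn
    rw [truncatedProb, if_pos (Finset.mem_Icc.2 ⟨ht, hn⟩)]
    rfl

theorem wedgeTerm_nonneg (hf : ∀ t, 0 ≤ f t) (t : ℕ × ℕ × ℕ) : 0 ≤ wedgeTerm f t := by
  rw [wedgeTerm]
  split_ifs with h
  · have h1 : (0 : ℝ) ≤ (t.1 : ℝ) - 1 := by
      rw [sub_nonneg]; exact_mod_cast h.1
    have := hf t.1
    have := hf t.2.1
    have := hf t.2.2
    positivity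
  · exact le_rfl

theorem summable_wedgeTerm (hf : ∀ t, 0 ≤ f t)
    (hmoment : Summable fun t : ℕ => (t : ℝ) ^ (4 / 3 : ℝ) * f t) : Summable (wedgeTerm f) := by
  have hg : ∀ t : ℕ, 0 ≤ (t : ℝ) ^ (4 / 3 : ℝ) * f t := fun t =>
    mul_nonneg (by positivity) (hf t)
  have h2 := hmoment.mul_of_nonneg hmoment hg hg
  have h3 := hmoment.mul_of_nonneg h2 hg (fun x => mul_nonneg (hg _) (hg _))
  refine Summable.of_nonneg_of_le (wedgeTerm_nonneg hf) (fun t => ?_) (h3.mul_left 2)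
  rw [wedgeTerm]
  split_ifs with h
  · have h4 := wedge_weight_le (a := t.1) (b := t.2.1) (c := t.2.2) (by omega) (by omega)
    have h5 : 0 ≤ f t.1 * f t.2.1 * f t.2.2 := mul_nonneg (mul_nonneg (hf _) (hf _)) (hf _)
    calc _ = ((t.1 : ℝ) * ((t.1 : ℝ) - 1) * t.2.1 * t.2.2) * (f t.1 * f t.2.1 * f t.2.2) := by ring
      _ ≤ _ := mul_le_mul_of_nonneg_right h4 h5
      _ = _ := by ring
  · have := hg t.1
    have := hg t.2.1
    have := hg t.2.2
    positivity

/-- The cube `{0, …, K}³`. -/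
def cube (K : ℕ) : Finset (ℕ × ℕ × ℕ) :=
  Finset.range (K + 1) ×ˢ (Finset.range (K + 1) ×ˢ Finset.range (K + 1))

theorem tendsto_sum_cube (h : Summable (wedgeTerm f)) :
    Tendsto (fun K => ∑ t ∈ cube K, wedgeTerm f t) atTop (𝓝 (∑' t, wedgeTerm f t)) := by
  refine h.hasSum.comp (tendsto_atTop_finset_of_monotone ?_ ?_)
  · intro K L hKL t ht
    simp only [cube, Finset.mem_product, Finset.mem_range] at ht ⊢
    omega
  · intro t
    refine ⟨t.1 + t.2.1 + t.2.2, ?_⟩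
    simp only [cube, Finset.mem_product, Finset.mem_range]
    omega

/-- For fixed K only finitely many triples contribute, so convergence of the truncated probabilities
suffices. Triples whose first coordinate is 0 contribute nothing because f(0) = 0. -/
theorem tendsto_capped_sum (hf_sum : HasSum f 1) (hf_zero : f 0 = 0) (K : ℕ) :
    Tendsto (fun n => ∑ a ∈ Finset.Icc 1 (degreeCap n), ∑ b ∈ Finset.Icc 1 (degreeCap n),
        ∑ c ∈ Finset.Icc 1 (degreeCap n),
          truncatedProb f n a * truncatedProb f n b * truncatedProb f n c *
            if CapOrdered K a b c then (a : ℝ) * ((a : ℝ) - 1) * b * c else 0) atTop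
      (𝓝 (∑ t ∈ cube K, wedgeTerm f t)) := by
  have h1 : Tendsto (fun n => ∑ t ∈ cube K,
      truncatedProb f n t.1 * truncatedProb f n t.2.1 * truncatedProb f n t.2.2 *
        if CapOrdered K t.1 t.2.1 t.2.2 then (t.1 : ℝ) * ((t.1 : ℝ) - 1) * t.2.1 * t.2.2 else 0)
      atTop (𝓝 (∑ t ∈ cube K, wedgeTerm f t)) := by
    refine tendsto_finsetSum _ fun t ht => ?_
    have h2 : wedgeTerm f t = f t.1 * f t.2.1 * f t.2.2 *
        if CapOrdered K t.1 t.2.1 t.2.2 then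
          (t.1 : ℝ) * ((t.1 : ℝ) - 1) * t.2.1 * t.2.2 else 0 := by
      simp only [cube, Finset.mem_product, Finset.mem_range] at ht
      rcases Nat.eq_zero_or_pos t.1 with h0 | h0
      · rw [h0, hf_zero, wedgeTerm, if_neg (by omega)]
        simp
      · by_cases hc : CapOrdered K t.1 t.2.1 t.2.2
        · rw [if_pos hc, wedgeTerm, if_pos ⟨h0, hc.1, hc.2.1⟩]
          ring
        · rw [if_neg hc, wedgeTerm, if_neg, mul_zero]
          rintro ⟨-, h3, h4⟩
          exact hc ⟨h3, h4, by omega, by omega, by omega⟩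
    rw [h2]
    exact (((tendsto_truncatedProb hf_sum hf_zero _).mul
      (tendsto_truncatedProb hf_sum hf_zero _)).mul
      (tendsto_truncatedProb hf_sum hf_zero _)).mul_const _
  refine h1.congr fun n => ?_
  set S := Finset.Icc 1 (degreeCap n) with hS
  have h3 : (∑ a ∈ S, ∑ b ∈ S, ∑ c ∈ S,
      truncatedProb f n a * truncatedProb f n b * truncatedProb f n c *
            if CapOrdered K a b c then (a : ℝ) * ((a : ℝ) - 1) * b * c else 0) =
      ∑ t ∈ S ×ˢ (S ×ˢ S),
        truncatedProb f n t.1 * truncatedProb f n t.2.1 * truncatedProb f n t.2.2 *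
        if CapOrdered K t.1 t.2.1 t.2.2 then
          (t.1 : ℝ) * ((t.1 : ℝ) - 1) * t.2.1 * t.2.2 else 0 := by
    rw [Finset.sum_product]
    refine Finset.sum_congr rfl fun a _ => ?_
    rw [Finset.sum_product]
  rw [h3]
  refine Finset.sum_congr_of_eq_on_inter ?_ ?_ fun _ _ _ => rfl
  · intro t _ ht
    have h4 : ∀ a, a ∉ S → truncatedProb f n a = 0 := fun a ha => by
      rw [truncatedProb, if_neg ha]
    simp only [Finset.mem_product, not_and_or] at ht
    rcases ht with h | h | h <;> simp [h4 _ h]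
  · intro t _ ht
    rw [if_neg, mul_zero]
    rintro ⟨-, -, h5, h6, h7⟩
    refine ht ?_
    simp only [cube, Finset.mem_product, Finset.mem_range]
    omega

theorem one_le_mean (hf : ∀ t, 0 ≤ f t) (hf_sum : HasSum f 1) (hf_zero : f 0 = 0)
    (hmean : Summable fun t : ℕ => (t : ℝ) * f t) : 1 ≤ ∑' t : ℕ, (t : ℝ) * f t := by
  rw [← hf_sum.tsum_eq]
  refine hf_sum.summable.tsum_le_tsum (fun t => ?_) hmean
  rcases Nat.eq_zero_or_pos t with rfl | ht
  · simp [hf_zero]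
  · have : (1 : ℝ) ≤ t := by exact_mod_cast ht
    nlinarith [hf t]

theorem summable_tail (hf : ∀ t, 0 ≤ f t)
    (hmoment : Summable fun t : ℕ => (t : ℝ) ^ (4 / 3 : ℝ) * f t) (K : ℕ) :
    Summable fun t : ℕ => (if K < t then (t : ℝ) ^ (4 / 3 : ℝ) else 0) * f t := by
  refine Summable.of_nonneg_of_le (fun t => mul_nonneg (by split_ifs <;> positivity) (hf t))
    (fun t => mul_le_mul_of_nonneg_right ?_ (hf t)) hmoment
  split_ifs
  · exact le_rfl
  · positivity

theorem tendsto_tail (hf : ∀ t, 0 ≤ f t)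
    (hmoment : Summable fun t : ℕ => (t : ℝ) ^ (4 / 3 : ℝ) * f t) :
    Tendsto (fun K : ℕ => ∑' t : ℕ, (if K < t then (t : ℝ) ^ (4 / 3 : ℝ) else 0) * f t) atTop
      (𝓝 0) := by
  have h := tendsto_tsum_of_dominated_convergence (𝓕 := atTop)
    (f := fun (K t : ℕ) => (if K < t then (t : ℝ) ^ (4 / 3 : ℝ) else 0) * f t)
    (g := fun _ => (0 : ℝ)) hmoment (fun t => ?_) (Eventually.of_forall fun K t => ?_)
  · simpa using h
  · refine tendsto_const_nhds.congr' ?_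
    filter_upwards [eventually_ge_atTop t] with K hK
    rw [if_neg (by omega), zero_mul]
  · rw [Real.norm_of_nonneg (mul_nonneg (by split_ifs <;> positivity) (hf t))]
    refine mul_le_mul_of_nonneg_right ?_ (hf t)
    split_ifs
    · exact le_rfl
    · positivity

theorem expectedWork_eq (f : ℕ → ℝ) (n : ℕ) :
    expectedWork f n = 1 / 2 * prodExp (Finset.Icc 1 (degreeCap n)) (truncatedProb f n)
      (fun d : Fin n → ℕ => matchAvg d (fun σ => ((bucketWedges d σ).card : ℝ))) := by
  rw [← prodExp_const_mul, expectedWork, prodExp]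
  refine Finset.sum_congr rfl fun d _ => ?_
  rw [← matchAvg_const_mul]
  congr 1
  simp only [ecmExpectation, matchAvg]
  congr 1
  refine Finset.sum_congr rfl fun σ hσ => ?_
  rw [← two_mul_bucketWork hσ]
  ring

/-- Every error term is bounded by an expression in M²/n, the truncated mean, the truncated 4/3
moment and its tail beyond K. Besides the arbitrarily small slack, only the tail survives, with
constant 24 = 4 · 6. -/
theorem eventually_abs_sub_le (hf : ∀ t, 0 ≤ f t) (hf_sum : HasSum f 1) (hf_zero : f 0 = 0)
    (hmean : Summable fun t : ℕ => (t : ℝ) * f t)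
    (hmoment : Summable fun t : ℕ => (t : ℝ) ^ (4 / 3 : ℝ) * f t) {K : ℕ} (hK : 16 ≤ K)
    {ε : ℝ} (hε : 0 < ε) :
    ∀ᶠ n : ℕ in atTop, |2 * (1 / (n : ℝ) * expectedWork f n) -
        1 / (∑' t : ℕ, (t : ℝ) * f t) ^ 2 * ∑ t ∈ cube K, wedgeTerm f t| ≤
      24 * (∑' t : ℕ, (t : ℝ) ^ (4 / 3 : ℝ) * f t) ^ 2 *
        (∑' t : ℕ, (if K < t then (t : ℝ) ^ (4 / 3 : ℝ) else 0) * f t) + ε := by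
  have hμ := one_le_mean hf hf_sum hf_zero hmean
  have hν := tendsto_sum_truncatedProb_mul hf_sum hf_zero hmean
  have hQ := tendsto_sum_truncatedProb_mul hf_sum hf_zero hmoment
  have hR := tendsto_sum_truncatedProb_mul hf_sum hf_zero (summable_tail hf hmoment K)
  have hω := tendsto_capped_sum hf_sum hf_zero K
  have hx := tendsto_degreeCap_sq_div
  have hinv : Tendsto (fun n : ℕ => 1 / (n : ℝ)) atTop (𝓝 0) := tendsto_one_div_atTop_nhds_zero_nat
  set μ := ∑' t : ℕ, (t : ℝ) * f t
  set A := ∑' t : ℕ, (t : ℝ) ^ (4 / 3 : ℝ) * f t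
  set R := ∑' t : ℕ, (if K < t then (t : ℝ) ^ (4 / 3 : ℝ) else 0) * f t
  have hK0 : (0 : ℝ) < K := by exact_mod_cast (by omega : 0 < K)
  -- The threshold of the weak law is fixed before n grows, so that its own contribution is exactly
  -- ε/4.
  obtain ⟨δ, hδ, hδε⟩ : ∃ δ : ℝ, 0 < δ ∧ 2 * (K : ℝ) ^ 4 * δ = ε / 4 :=
    ⟨ε / (8 * (K : ℝ) ^ 4), by positivity, by field_simp; norm_num⟩
  set ν : ℕ → ℝ := fun n => ∑ t ∈ Finset.Icc 1 (degreeCap n), truncatedProb f n t * (t : ℝ)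
  set Q : ℕ → ℝ := fun n => ∑ t ∈ Finset.Icc 1 (degreeCap n),
    truncatedProb f n t * (t : ℝ) ^ (4 / 3 : ℝ)
  set T : ℕ → ℝ := fun n => ∑ t ∈ Finset.Icc 1 (degreeCap n),
    truncatedProb f n t * (if K < t then (t : ℝ) ^ (4 / 3 : ℝ) else 0)
  set x : ℕ → ℝ := fun n => (degreeCap n : ℝ) ^ 2 / n
  have hxν : Tendsto (fun n => x n * ν n) atTop (𝓝 0) := by simpa using hx.mul hν
  have hE : Tendsto (fun n : ℕ => 16 * (K : ℝ) ^ 4 * (1 / n) + 2 * (K : ℝ) ^ 4 *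
        (|ν n - μ| + δ + x n * ν n / δ) + 4 * (6 * Q n ^ 2 * T n) +
      3 * (K : ℝ) ^ 4 * (2 * (1 / n) + 4 * (x n * ν n)) +
      (8 * (x n * ν n) + 512 * (x n ^ 2 * Q n ^ 3 + x n ^ 3 * ν n ^ 2))) atTop
      (𝓝 (16 * (K : ℝ) ^ 4 * 0 + 2 * (K : ℝ) ^ 4 * (|μ - μ| + δ + 0 / δ) + 4 * (6 * A ^ 2 * R) +
      3 * (K : ℝ) ^ 4 * (2 * 0 + 4 * 0) +
      (8 * 0 + 512 * (0 ^ 2 * A ^ 3 + 0 ^ 3 * μ ^ 2)))) := by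
    refine ((((hinv.const_mul _).add ((((hν.sub_const μ).abs.add_const δ).add
      (hxν.div_const δ)).const_mul _)).add ((((hQ.pow 2).const_mul 6).mul hR).const_mul 4)).add
      (((hinv.const_mul 2).add (hxν.const_mul 4)).const_mul _)).add
      ((hxν.const_mul 8).add ((((hx.pow 2).mul (hQ.pow 3)).add
        ((hx.pow 3).mul (hν.pow 2))).const_mul 512))
  have hlim : 16 * (K : ℝ) ^ 4 * 0 + 2 * (K : ℝ) ^ 4 * (|μ - μ| + δ + 0 / δ) +
      4 * (6 * A ^ 2 * R) + 3 * (K : ℝ) ^ 4 * (2 * 0 + 4 * 0) +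
      (8 * 0 + 512 * (0 ^ 2 * A ^ 3 + 0 ^ 3 * μ ^ 2)) = 24 * A ^ 2 * R + ε / 4 := by
    rw [← hδε, sub_self, abs_zero]
    ring
  rw [hlim] at hE
  have hc : Tendsto (fun n : ℕ => ((n : ℝ) - 1) * ((n : ℝ) - 2) / n ^ 2 * (1 / μ ^ 2)) atTop
      (𝓝 (1 / μ ^ 2)) := by
    have h1 : Tendsto (fun n : ℕ => (1 - 1 / (n : ℝ)) * (1 - 2 * (1 / (n : ℝ))) * (1 / μ ^ 2)) atTop
        (𝓝 ((1 - 0) * (1 - 2 * 0) * (1 / μ ^ 2))) :=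
      ((hinv.const_sub 1).mul ((hinv.const_mul 2).const_sub 1)).mul_const _
    have h2 : (1 - 0) * (1 - 2 * 0) * (1 / μ ^ 2) = 1 / μ ^ 2 := by ring
    rw [h2] at h1
    refine h1.congr' ?_
    filter_upwards [eventually_gt_atTop 0] with n hn
    have : (0 : ℝ) < n := by exact_mod_cast hn
    field_simp
  have hcω := hc.mul hω
  filter_upwards [eventually_ge_atTop 16, eventually_sum_truncatedProb hf_sum hf_zero,
    hE.eventually (gt_mem_nhds (by linarith : 24 * A ^ 2 * R + ε / 4 < 24 * A ^ 2 * R + ε / 2)),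
    (Metric.tendsto_nhds.1 hcω) (ε / 2) (by linarith)] with n hn h1 hEn hdist
  have hn0 : (0 : ℝ) < n := by exact_mod_cast (by omega : 0 < n)
  have hp : ∀ t ∈ Finset.Icc 1 (degreeCap n), 0 ≤ truncatedProb f n t := fun t _ =>
    truncatedProb_nonneg hf n t
  have hM : ∀ t ∈ Finset.Icc 1 (degreeCap n), t ≤ degreeCap n := fun t ht =>
    (Finset.mem_Icc.1 ht).2
  have key := abs_prodExp_bucketWedges_sub_le (S := Finset.Icc 1 (degreeCap n))
    (p := truncatedProb f n) (n := n) (fun t ht => (Finset.mem_Icc.1 ht).1) hp h1 hn hK hμ hδ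
  rw [Real.dist_eq] at hdist
  have hν0 : 0 ≤ ν n := Finset.sum_nonneg fun t ht => mul_nonneg (hp t ht) (Nat.cast_nonneg t)
  have m2 : (∑ t ∈ Finset.Icc 1 (degreeCap n), truncatedProb f n t * (t : ℝ) ^ 2) / n ≤
      x n * ν n := by
    have h2 := sum_mul_pow_succ_le hp hM 1
    -- One power of the cap would suffice here; the square is used to express this error too through
    -- M²/n.
    have h3 : (degreeCap n : ℝ) ^ 1 ≤ (degreeCap n : ℝ) ^ 2 := by
      rcases Nat.eq_zero_or_pos (degreeCap n) with h | h
      · simp [h]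
      · exact pow_le_pow_right₀ (by exact_mod_cast h) (by norm_num)
    calc _ ≤ ((degreeCap n : ℝ) ^ 2 * ν n) / n := by
          gcongr
          exact h2.trans (by gcongr)
      _ = _ := by simp only [x]; ring
  have m3 : (∑ t ∈ Finset.Icc 1 (degreeCap n), truncatedProb f n t * (t : ℝ) ^ 3) / n ≤
      x n * ν n := by
    calc _ ≤ ((degreeCap n : ℝ) ^ 2 * ν n) / n := by
          gcongr
          exact sum_mul_pow_succ_le hp hM 2
      _ = _ := by simp only [x]; ring
  have m4 : (∑ t ∈ Finset.Icc 1 (degreeCap n), truncatedProb f n t * (t : ℝ) ^ 4) ^ 2 / n ^ 3 ≤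
      x n ^ 3 * ν n ^ 2 := by
    have h20 : 0 ≤ ∑ t ∈ Finset.Icc 1 (degreeCap n), truncatedProb f n t * (t : ℝ) ^ 4 :=
      Finset.sum_nonneg fun t ht => mul_nonneg (hp t ht) (by positivity)
    calc _ ≤ ((degreeCap n : ℝ) ^ 3 * ν n) ^ 2 / n ^ 3 := by
          gcongr
          exact sum_mul_pow_succ_le hp hM 3
      _ = _ := by simp only [x]; ring
  have m42 : (∑ t ∈ Finset.Icc 1 (degreeCap n), truncatedProb f n t * (t : ℝ) ^ 4) *
      (∑ t ∈ Finset.Icc 1 (degreeCap n), truncatedProb f n t * (t : ℝ) ^ 2) ^ 2 / n ^ 2 ≤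
      x n ^ 2 * Q n ^ 3 := by
    calc _ ≤ ((degreeCap n : ℝ) ^ 4 * Q n ^ 3) / n ^ 2 := by
          exact div_le_div_of_nonneg_right (fourth_mul_sq_second_le hp hM) (by positivity)
      _ = _ := by simp only [x]; ring
  have mT := tail_sum_le hp K
  have m2' : (∑ t ∈ Finset.Icc 1 (degreeCap n), truncatedProb f n t * (t : ℝ) ^ 2) / (n * δ) ≤
      x n * ν n / δ := by
    rw [← div_div]
    gcongr
  have hle := key.trans (b := _) (c := 24 * A ^ 2 * R + ε / 2) (by
    refine le_trans ?_ hEn.le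
    gcongr)
  rw [expectedWork_eq]
  have hw : ∀ w : ℝ, 2 * (1 / (n : ℝ) * (1 / 2 * w)) = 1 / n * w := fun w => by ring
  rw [hw]
  refine (abs_sub_le _ _ _).trans ((add_le_add hle hdist.le).trans ?_)
  linarith

theorem tendsto_expectedWork (hf : ∀ t, 0 ≤ f t) (hf_sum : HasSum f 1) (hf_zero : f 0 = 0)
    (hmean : Summable fun t : ℕ => (t : ℝ) * f t)
    (hmoment : Summable fun t : ℕ => (t : ℝ) ^ (4 / 3 : ℝ) * f t) :
    Tendsto (fun n : ℕ => 1 / (n : ℝ) * expectedWork f n) atTop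
      (𝓝 (1 / (2 * (∑' t : ℕ, (t : ℝ) * f t) ^ 2) * ∑' t : ℕ × ℕ × ℕ, wedgeTerm f t)) := by
  suffices h : Tendsto (fun n : ℕ => 2 * (1 / (n : ℝ) * expectedWork f n)) atTop
      (𝓝 (1 / (∑' t : ℕ, (t : ℝ) * f t) ^ 2 * ∑' t : ℕ × ℕ × ℕ, wedgeTerm f t)) by
    have h' := h.const_mul (1 / 2)
    have e1 : ∀ n : ℕ, 1 / 2 * (2 * (1 / (n : ℝ) * expectedWork f n)) =
        1 / (n : ℝ) * expectedWork f n := fun n => by ring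
    simp only [e1] at h'
    convert h' using 2
    rw [← mul_assoc, one_div_mul_one_div]
  rw [Metric.tendsto_nhds]
  intro ε hε
  have h1 := ((tendsto_sum_cube (summable_wedgeTerm hf hmoment)).const_mul
    (1 / (∑' t : ℕ, (t : ℝ) * f t) ^ 2))
  have h2 := (tendsto_tail hf hmoment).const_mul
    (24 * (∑' t : ℕ, (t : ℝ) ^ (4 / 3 : ℝ) * f t) ^ 2)
  rw [mul_zero] at h2
  -- The cube sum is within ε/3 of its limit and the tail error is below ε/3; with slack ε/4 at
  -- fixed K the total stays below ε.
  obtain ⟨K, hK, hK1, hK2⟩ := ((eventually_ge_atTop 16).and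
    (((Metric.tendsto_nhds.1 h1) (ε / 3) (by linarith)).and
      (h2.eventually (gt_mem_nhds (by linarith : (0 : ℝ) < ε / 3))))).exists
  filter_upwards [eventually_abs_sub_le hf hf_sum hf_zero hmean hmoment hK
    (by linarith : 0 < ε / 4)] with n hn
  rw [Real.dist_eq] at hK1 ⊢
  refine lt_of_le_of_lt (abs_sub_le _ _ _) (lt_of_lt_of_le (add_lt_add_of_le_of_lt hn hK1) ?_)
  linarith

/-- If f(1) < 1, some t ≥ 2 carries mass, and the diagonal triple (t, t, t) is already a positive
term. -/
theorem tsum_wedgeTerm_pos (hf : ∀ t, 0 ≤ f t) (hf_sum : HasSum f 1) (hf_zero : f 0 = 0)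
    (hmoment : Summable fun t : ℕ => (t : ℝ) ^ (4 / 3 : ℝ) * f t) (h1 : f 1 < 1) :
    0 < ∑' t : ℕ × ℕ × ℕ, wedgeTerm f t := by
  obtain ⟨t, ht, hft⟩ : ∃ t, 2 ≤ t ∧ 0 < f t := by
    by_contra! h
    have h2 : HasSum f (f 1) := hasSum_single 1 fun t ht => by
      rcases Nat.eq_zero_or_pos t with rfl | h0
      · exact hf_zero
      · exact le_antisymm (h t (by omega)) (hf t)
    exact h1.ne (h2.unique hf_sum)
  refine (summable_wedgeTerm hf hmoment).tsum_pos (wedgeTerm_nonneg hf) (t, t, t) ?_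
  rw [wedgeTerm, if_pos ⟨by omega, le_rfl, le_rfl⟩]
  have h3 : (2 : ℝ) ≤ t := by exact_mod_cast ht
  have h4 : (0 : ℝ) < (t : ℝ) - 1 := by linarith
  have h5 : (0 : ℝ) < t := by linarith
  positivity

end Limit

theorem mainTheorem4 (f : ℕ → ℝ) (hf_nonneg : ∀ t, 0 ≤ f t) (hf_sum : HasSum f 1)
    (hf_zero : f 0 = 0)
    (hmean : Summable fun t : ℕ => (t : ℝ) * f t)
    (hmoment : Summable fun t : ℕ => (t : ℝ) ^ (4 / 3 : ℝ) * f t) :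
    Summable (wedgeTerm f) ∧
    Tendsto (fun n : ℕ => 1 / (n : ℝ) * expectedWork f n) atTop
      (𝓝 (1 / (2 * (∑' t : ℕ, (t : ℝ) * f t) ^ 2) * ∑' t : ℕ × ℕ × ℕ, wedgeTerm f t)) ∧
    (f 1 < 1 →
      0 < 1 / (2 * (∑' t : ℕ, (t : ℝ) * f t) ^ 2) * ∑' t : ℕ × ℕ × ℕ, wedgeTerm f t) := by
  refine ⟨summable_wedgeTerm hf_nonneg hmoment,
    tendsto_expectedWork hf_nonneg hf_sum hf_zero hmean hmoment, fun h1 => ?_⟩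
  have h2 := one_le_mean hf_nonneg hf_sum hf_zero hmean
  have h3 := tsum_wedgeTerm_pos hf_nonneg hf_sum hf_zero hmoment h1
  positivity
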